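/- **Convex combination spaces.** A convex combination space is a metric space $(\mathfrak X,d)$ with an operation that assigns to all $n\ge 1$, $\lambda_1,\dots,\lambda_n>0$ with $\sum_i\lambda_i=1$ and $u_1,\dots,u_n\in\mathfrak X$ an element $[\lambda_i,u_i]_{i=1}^n=[\lambda_1,u_1;\dots;\lambda_n,u_n]$ of $\mathfrak X$, such that $[1,u]=u$ and 1. $[\lambda_i,u_i]_{i=1}^n=[\lambda_{\sigma(i)},u_{\sigma(i)}]_{i=1}^n$ for every permutation $\sigma$ of $\{1,\dots,n\}$; 2. $[\lambda_i,u_i]_{i=1}^{n+2}=\big[\lambda_1,u_1;\dots;\lambda_n,u_n;\lambda_{n+1}+\lambda_{n+2},\big[\tfrac{\lambda_{n+1}}{\lambda_{n+1}+\lambda_{n+2}},u_{n+1};\tfrac{\lambda_{n+2}}{\lambda_{n+1}+\lambda_{n+2}},u_{n+2}\big]\big]$; 3. if $\lambda^{(k)}\to\lambda$ in $(0,1)$, then $[\lambda^{(k)},u;1-\lambda^{(k)},v]\to[\lambda,u;1-\lambda,v]$; 4. $d([\lambda,u_1;1-\lambda,u_2],[\lambda,v_1;1-\lambda,v_2])\le\lambda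 d(u_1,v_1)+(1-\lambda)d(u_2,v_2)$ for $\lambda\in(0,1)$; 5. for each $u\in\mathfrak X$ the limit $Ku:=\lim_{n\to\infty}[n^{-1},u]_{i=1}^n$ exists. For points of $K(\mathfrak X)$, weights equal to $0$ are also allowed; the corresponding entries are left out. **Conditional expectation.** Let $\mathfrak X$ be separable and complete, $(\Omega,\mathcal F,P)$ a probability space and $\mathcal G\subset\mathcal F$ a sub-$\sigma$-algebra. A random element is a Borel measurable map $X:\Omega\to\mathfrak X$; it is integrable ($X\in L^1_{\mathfrak X}$) if $E\,d(a,X)<\infty$ for some $a\in\mathfrak X$. For a random element $X$ with finitely many values $x_1,\dots,x_n$ (distinct), put $E(X|\mathcal G)=[E(I_{\{X=x_i\}}|\mathcal G),Kx_i]_{i=1}^n$. In general, fix $u_0\in K(\mathfrak X)$ and a sequence $(u_j)_{j\ge1}$ whose values are dense in $\mathfrak X$, let $\psi_n(x)$ be the point of $u_0,\dots,u_n$ nearest to $x$ (the one of smallest index in case of a tie), and for $X\in L^1_{\mathfrak X}$ let $E(X|\mathcal G)$ be the $\mathcal G$-measurable almost sure limit of $E(\psi_n(X)|\mathcal G)$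 as $n\to\infty$, defined up to a null set. **Proposition 4.11 (conditional Jensen inequality).** Let $\varphi:\mathfrak X\to\mathbb R$ be continuous and midpoint convex, i.e. $\varphi([\tfrac12,x;\tfrac12,y])\le\tfrac12(\varphi(x)+\varphi(y))$ for all $x,y\in\mathfrak X$, and let $X\in L^1_{\mathfrak X}$ be such that $\varphi(X)$ is integrable. Then, for every choice of $(u_j)_{j\ge0}$ as above, $E(X|\mathcal G)$ exists and $$\varphi(E(X|\mathcal G))\le E(\varphi(X)|\mathcal G)\quad\text{a.s.}$$ -/

import Mathlib

open MeasureTheory Filter Topology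

noncomputable section

/-- Positive weights that sum to one. -/
def IsPosWeights {n : ℕ} (w : Fin n → ℝ) : Prop :=
  (∀ i, 0 < w i) ∧ ∑ i, w i = 1

/-- A convex combination space: a metric space with a convex combination operation
`comb w u = [w₁, u₁; …; wₙ, uₙ]`. Only its values at positive weights that sum to one have a
meaning; every law is restricted to such weights. -/
class ConvexCombinationSpace (𝔛 : Type*) [MetricSpace 𝔛] where
  /-- The convex combination `[w₁, u₁; …; wₙ, uₙ]`. -/
  comb : {n : ℕ} → (Fin n → ℝ) → (Fin n → 𝔛) → 𝔛
  /-- `[1, x] = x`. -/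
  comb_one : ∀ x : 𝔛, comb ![(1 : ℝ)] ![x] = x
  /-- Commutativity. -/
  comb_perm : ∀ {n : ℕ} (σ : Equiv.Perm (Fin n)) (w : Fin n → ℝ) (u : Fin n → 𝔛),
    IsPosWeights w → comb w u = comb (w ∘ σ) (u ∘ σ)
  /-- Associativity:
  `[w₁, u₁; …; wₙ, uₙ; a, x; b, y]
    = [w₁, u₁; …; wₙ, uₙ; a + b, [a / (a + b), x; b / (a + b), y]]`. -/
  comb_assoc : ∀ {n : ℕ} (w : Fin n → ℝ) (a b : ℝ) (u : Fin n → 𝔛) (x y : 𝔛),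
    IsPosWeights (Fin.snoc (α := fun _ => ℝ) (Fin.snoc (α := fun _ => ℝ) w a) b) →
    comb (Fin.snoc (α := fun _ => ℝ) (Fin.snoc (α := fun _ => ℝ) w a) b)
        (Fin.snoc (α := fun _ => 𝔛) (Fin.snoc (α := fun _ => 𝔛) u x) y)
      = comb (Fin.snoc (α := fun _ => ℝ) w (a + b))
        (Fin.snoc (α := fun _ => 𝔛) u (comb ![a / (a + b), b / (a + b)] ![x, y]))
  /-- Continuity in the weight. -/
  comb_continuous : ∀ u v : 𝔛,
    ContinuousOn (fun t : ℝ => comb ![t, 1 - t] ![u, v]) (Set.Ioo 0 1)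
  /-- Negative curvature. -/
  dist_comb_le : ∀ (u₁ u₂ v₁ v₂ : 𝔛) (t : ℝ), t ∈ Set.Ioo (0 : ℝ) 1 →
    dist (comb ![t, 1 - t] ![u₁, u₂]) (comb ![t, 1 - t] ![v₁, v₂])
      ≤ t * dist u₁ v₁ + (1 - t) * dist u₂ v₂
  /-- Convexification: the limit of `[1/n, u; …; 1/n, u]` (`n` entries) exists. -/
  exists_convexification : ∀ u : 𝔛, ∃ l : 𝔛,
    Tendsto (fun n : ℕ => comb (fun _ : Fin (n + 1) => 1 / ((n : ℝ) + 1)) (fun _ => u))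
      atTop (𝓝 l)

namespace ConvexCombinationSpace

variable {𝔛 : Type*} [MetricSpace 𝔛] [ConvexCombinationSpace 𝔛]

/-- The convexification operator `K u = lim [1/n, u; …; 1/n, u]`. -/
def convexify (u : 𝔛) : 𝔛 :=
  Classical.choose (exists_convexification u)

/-- Midpoint convexity of a real function. -/
def MidpointConvex (φ : 𝔛 → ℝ) : Prop :=
  ∀ x y : 𝔛, φ (comb ![1 / 2, 1 / 2] ![x, y]) ≤ (φ x + φ y) / 2

open Classical in
/-- The combination of a finite family `(x i)`, `i ∈ s`, of convex points with nonnegative weights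
that sum to one: entries of weight zero are left out. By commutativity the enumeration of the
remaining entries does not matter. -/
def combFinset {ι : Type*} (s : Finset ι) (w : ι → ℝ) (x : ι → 𝔛) : 𝔛 :=
  comb (fun k => w ((s.filter fun i => 0 < w i).equivFin.symm k))
    (fun k => x ((s.filter fun i => 0 < w i).equivFin.symm k))

variable {Ω : Type*} [MeasurableSpace 𝔛]

/-- The conditional expectation `[E(I(Z = x) | 𝒢), K x]`, `x` running through the values of `Z`,
of a simple random element `Z`. -/
def condExpSimple (𝒢 : MeasurableSpace Ω) {ℱ : MeasurableSpace Ω} (P : Measure Ω)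
    (Z : @SimpleFunc Ω ℱ 𝔛) (ω : Ω) : 𝔛 :=
  combFinset Z.range (fun x => (P[(Z ⁻¹' {x}).indicator (fun _ => (1 : ℝ)) | 𝒢]) ω) convexify

/-- An integrable random element. -/
def IntegrableElement {ℱ : MeasurableSpace Ω} (P : Measure Ω) (X : Ω → 𝔛) : Prop :=
  Measurable X ∧ ∃ a : 𝔛, Integrable (fun ω => dist a (X ω)) P

/-- `Y` is (a version of) `E(X | 𝒢)`: it is `𝒢`-measurable and the almost sure limit of
`E(ψₙ(X) | 𝒢)`, where `ψₙ x`, which is `SimpleFunc.nearestPt u n x`, is the point nearest to `x`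
among `u 0, …, u n` (the one of least index in case of a tie). -/
def IsCondExp [OpensMeasurableSpace 𝔛] (𝒢 : MeasurableSpace Ω) {ℱ : MeasurableSpace Ω}
    (P : Measure Ω) (u : ℕ → 𝔛) (X : Ω → 𝔛) (hX : Measurable[ℱ] X) (Y : Ω → 𝔛) : Prop :=
  Measurable[𝒢] Y ∧
    ∀ᵐ ω ∂P, Tendsto (fun n => condExpSimple 𝒢 P ((SimpleFunc.nearestPt u n).comp X hX) ω)
      atTop (𝓝 (Y ω))

end ConvexCombinationSpace

end

noncomputable section

/-! The inequality is finite convexity for simple elements, followed by a limit along simple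
elements that approximate `X` and `φ(X)` simultaneously.

Finite part: commutativity and associativity make a combination a function of a weighted multiset in
which any part may be replaced by its barycenter (`barycenter_join`). Every `K x` is a convex point,
unchanged when combined with itself (`isConvexPoint_convexify`). Segments between convex points are
therefore affinely parametrized, and continuity upgrades midpoint convexity to convexity along them
(`MidpointConvex.comb_pair_le`). Together with `φ (K x) ≤ φ x` (`MidpointConvex.convexify_le`) this
gives φ(E(Z|𝒢)) ≤ E(φ(Z)|𝒢) for simple Z.

Limit part: negative curvature gives d(E(Z|𝒢), E(Z'|𝒢)) ≤ E(d(Z, Z')|𝒢) for simple Z, Z'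
(`dist_condExpSimple_le`). The errors d(ψₙ(X), X) decrease to 0 below an integrable function, so
their conditional expectations tend to 0 a.s. and E(ψₙ(X)|𝒢) is a.s. Cauchy. Since `φ` is only
continuous, φ(ψₙ(X)) need not approach φ(X) in L¹. For Jensen, the pair (X, φ(X)) is instead
approximated by nearest points on the graph of `φ`. The first coordinates Vₙ satisfy E(Vₙ|𝒢) →
E(X|𝒢), while φ(Vₙ) exceeds φ(X) by at most an error whose conditional expectation vanishes. -/

theorem exists_perm_of_map_univ_eq {α β : Type*} [Fintype α] {f g : α → β}
    (h : Finset.univ.val.map f = Finset.univ.val.map g) : ∃ σ : Equiv.Perm α, f = g ∘ σ := by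
  classical
  have key : ∀ c : β, Nonempty ({a // f a = c} ≃ {a // g a = c}) := fun c => by
    rw [← Fintype.card_eq, Fintype.card_subtype, Fintype.card_subtype]
    have := congrArg (Multiset.count c) h
    simp only [Multiset.count_map, eq_comm (a := c)] at this
    exact this
  -- Corresponding fibres have equal cardinality, so chosen bijections between them glue to a
  -- permutation.
  exact ⟨Equiv.ofFiberEquiv fun c => (key c).some,
    funext fun a => (Equiv.ofFiberEquiv_map (fun c => (key c).some) a).symm⟩

namespace ConvexCombinationSpace

/-! ### Combinations as barycenters of weighted multisets -/

section Barycenter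

variable {𝔛 : Type*}

/-- The sum of the weights of a weighted multiset. -/
def totalWeight (M : Multiset (ℝ × 𝔛)) : ℝ := (M.map Prod.fst).sum

/-- All weights are positive. -/
def PosWeighted (M : Multiset (ℝ × 𝔛)) : Prop := ∀ p ∈ M, 0 < p.1

/-- Multiply all weights by `c`. -/
def scaleWeights (c : ℝ) (M : Multiset (ℝ × 𝔛)) : Multiset (ℝ × 𝔛) := M.map fun p => (c * p.1, p.2)

@[simp] theorem totalWeight_zero : totalWeight (0 : Multiset (ℝ × 𝔛)) = 0 := by simp [totalWeight]

@[simp] theorem totalWeight_cons (p : ℝ × 𝔛) (M : Multiset (ℝ × 𝔛)) :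
    totalWeight (p ::ₘ M) = p.1 + totalWeight M := by simp [totalWeight]

@[simp] theorem totalWeight_singleton (p : ℝ × 𝔛) : totalWeight {p} = p.1 := by simp [totalWeight]

@[simp] theorem totalWeight_add (M N : Multiset (ℝ × 𝔛)) :
    totalWeight (M + N) = totalWeight M + totalWeight N := by simp [totalWeight]

@[simp] theorem totalWeight_scaleWeights (c : ℝ) (M : Multiset (ℝ × 𝔛)) :
    totalWeight (scaleWeights c M) = c * totalWeight M := by
  simp [totalWeight, scaleWeights, Multiset.sum_map_mul_left]

@[simp] theorem scaleWeights_cons (c : ℝ) (p : ℝ × 𝔛) (M : Multiset (ℝ × 𝔛)) :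
    scaleWeights c (p ::ₘ M) = (c * p.1, p.2) ::ₘ scaleWeights c M := by simp [scaleWeights]

@[simp] theorem scaleWeights_singleton (c : ℝ) (p : ℝ × 𝔛) :
    scaleWeights c {p} = {(c * p.1, p.2)} := by simp [scaleWeights]

@[simp] theorem posWeighted_cons {p : ℝ × 𝔛} {M : Multiset (ℝ × 𝔛)} :
    PosWeighted (p ::ₘ M) ↔ 0 < p.1 ∧ PosWeighted M := by simp [PosWeighted]

@[simp] theorem posWeighted_singleton {p : ℝ × 𝔛} : PosWeighted {p} ↔ 0 < p.1 := by
  simp [PosWeighted]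

@[simp] theorem posWeighted_add {M N : Multiset (ℝ × 𝔛)} :
    PosWeighted (M + N) ↔ PosWeighted M ∧ PosWeighted N := by
  simp only [PosWeighted, Multiset.mem_add, or_imp, forall_and]

theorem PosWeighted.scaleWeights {M : Multiset (ℝ × 𝔛)} (hM : PosWeighted M) {c : ℝ} (hc : 0 < c) :
    PosWeighted (scaleWeights c M) := by
  intro p hp
  obtain ⟨q, hq, rfl⟩ := Multiset.mem_map.1 hp
  exact mul_pos hc (hM q hq)

theorem PosWeighted.totalWeight_nonneg {M : Multiset (ℝ × 𝔛)} (hM : PosWeighted M) :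
    0 ≤ totalWeight M :=
  Multiset.sum_nonneg fun x hx => by
    obtain ⟨p, hp, rfl⟩ := Multiset.mem_map.1 hx
    exact (hM p hp).le

theorem PosWeighted.totalWeight_pos {M : Multiset (ℝ × 𝔛)} (hM : PosWeighted M) (h0 : M ≠ 0) :
    0 < totalWeight M := by
  induction M using Multiset.induction with
  | empty => exact absurd rfl h0
  | cons p M _ =>
    rw [posWeighted_cons] at hM
    rw [totalWeight_cons]
    exact add_pos_of_pos_of_nonneg hM.1 hM.2.totalWeight_nonneg

theorem map_univ_toList_get {α β : Type*} (M : Multiset α) (f : α → β) :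
    Finset.univ.val.map (fun i : Fin M.toList.length => f (M.toList.get i)) = M.map f := by
  rw [Fin.univ_val_map]
  conv_rhs => rw [← Multiset.coe_toList M]
  rw [Multiset.map_coe]
  congr 1
  exact List.ext_get (by simp) (by simp)

theorem exists_isPosWeights {M : Multiset (ℝ × 𝔛)} (hM : PosWeighted M) (h0 : M ≠ 0) :
    ∃ (n : ℕ) (w : Fin n → ℝ) (u : Fin n → 𝔛), IsPosWeights w ∧
      scaleWeights (totalWeight M)⁻¹ M = Finset.univ.val.map fun i => (w i, u i) := by
  have hp := hM.totalWeight_pos h0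
  set N := scaleWeights (totalWeight M)⁻¹ M
  have hN : PosWeighted N := hM.scaleWeights (inv_pos.2 hp)
  refine ⟨N.toList.length, fun i => (N.toList.get i).1, fun i => (N.toList.get i).2, ⟨fun i => ?_, ?_⟩, ?_⟩
  · exact hN _ (Multiset.mem_toList.1 (List.get_mem _ _))
  · have : totalWeight N = 1 := by simp [N, hp.ne']
    rw [← this, totalWeight, ← map_univ_toList_get N Prod.fst]
    rfl
  · exact ((map_univ_toList_get N id).trans (Multiset.map_id N)).symm

theorem scaleWeights_scaleWeights (a b : ℝ) (M : Multiset (ℝ × 𝔛)) :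
    scaleWeights a (scaleWeights b M) = scaleWeights (a * b) M := by
  simp [scaleWeights, Multiset.map_map, mul_assoc]

theorem isPosWeights_pair {t : ℝ} (ht : t ∈ Set.Ioo (0 : ℝ) 1) : IsPosWeights ![t, 1 - t] :=
  ⟨fun i => by fin_cases i <;> simp [ht.1, ht.2], by simp⟩

theorem univ_map_snoc {n : ℕ} {α β : Type*} (w : Fin n → α) (u : Fin n → β) (a : α) (x : β) :
    (Finset.univ.val.map fun i => (Fin.snoc (α := fun _ => α) w a i, Fin.snoc (α := fun _ => β) u x i))
      = (a, x) ::ₘ Finset.univ.val.map fun i => (w i, u i) := by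
  rw [Fin.univ_val_map, Fin.univ_val_map, List.ofFn_succ']
  simp [List.concat_eq_append, ← Multiset.coe_add, add_comm]

variable [MetricSpace 𝔛] [ConvexCombinationSpace 𝔛]

/-- The convex combination of a weighted multiset, the weights being normalized. -/
def barycenter (M : Multiset (ℝ × 𝔛)) : 𝔛 :=
  comb (fun i : Fin M.toList.length => (M.toList.get i).1 / totalWeight M)
    (fun i => (M.toList.get i).2)

theorem comb_congr {n m : ℕ} {w : Fin n → ℝ} {w' : Fin m → ℝ} {u : Fin n → 𝔛} {u' : Fin m → 𝔛}
    (hw : IsPosWeights w)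
    (h : Finset.univ.val.map (fun i => (w i, u i)) = Finset.univ.val.map fun i => (w' i, u' i)) :
    comb w u = comb w' u' := by
  have hnm : n = m := by simpa using congrArg Multiset.card h
  subst hnm
  obtain ⟨σ, hσ⟩ := exists_perm_of_map_univ_eq h.symm
  rw [comb_perm σ w u hw]
  congr 1
  · exact (funext fun i => congrArg Prod.fst (congrFun hσ i)).symm
  · exact (funext fun i => congrArg Prod.snd (congrFun hσ i)).symm

theorem barycenter_eq_comb {n : ℕ} {M : Multiset (ℝ × 𝔛)} {w : Fin n → ℝ} {u : Fin n → 𝔛}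
    (hw : IsPosWeights w)
    (h : scaleWeights (totalWeight M)⁻¹ M = Finset.univ.val.map fun i => (w i, u i)) :
    barycenter M = comb w u := by
  refine (comb_congr hw ?_).symm
  rw [← h, map_univ_toList_get M fun p => (p.1 / totalWeight M, p.2)]
  exact Multiset.map_congr rfl fun p _ => by rw [div_eq_inv_mul]

theorem barycenter_scaleWeights {M : Multiset (ℝ × 𝔛)} (hM : PosWeighted M) {c : ℝ} (hc : 0 < c) :
    barycenter (scaleWeights c M) = barycenter M := by
  rcases eq_or_ne M 0 with rfl | h0
  · simp [scaleWeights]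
  obtain ⟨n, w, u, hw, h⟩ := exists_isPosWeights hM h0
  rw [barycenter_eq_comb hw h]
  refine barycenter_eq_comb hw ?_
  rw [← h, scaleWeights_scaleWeights, totalWeight_scaleWeights]
  congr 1
  field_simp

theorem comb_eq_barycenter {n : ℕ} {w : Fin n → ℝ} (hw : IsPosWeights w) (u : Fin n → 𝔛) :
    comb w u = barycenter (Finset.univ.val.map fun i => (w i, u i)) := by
  refine (barycenter_eq_comb hw ?_).symm
  have : totalWeight (Finset.univ.val.map fun i => (w i, u i)) = 1 := by
    rw [← hw.2, totalWeight, Multiset.map_map]; rfl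
  rw [this, scaleWeights, Multiset.map_map]
  simp only [inv_one, one_mul, Function.comp_def]

theorem comb_pair_eq_barycenter {t : ℝ} (ht : t ∈ Set.Ioo (0 : ℝ) 1) (x y : 𝔛) :
    comb ![t, 1 - t] ![x, y] = barycenter {(t, x), (1 - t, y)} := by
  rw [comb_eq_barycenter (isPosWeights_pair ht), Fin.univ_val_map]
  simp [List.ofFn_succ]
  rfl

theorem barycenter_pair {a b : ℝ} (ha : 0 < a) (hb : 0 < b) (x y : 𝔛) :
    barycenter {(a, x), (b, y)} = comb ![a / (a + b), 1 - a / (a + b)] ![x, y] := by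
  have hab : 0 < a + b := add_pos ha hb
  have h1 : b / (a + b) = 1 - a / (a + b) := by field_simp; ring
  rw [comb_pair_eq_barycenter ⟨by positivity, by rw [div_lt_one hab]; linarith⟩,
    ← barycenter_scaleWeights (c := (a + b)⁻¹) (by simp [PosWeighted, ha, hb]) (by positivity), ← h1]
  simp [Multiset.insert_eq_cons, div_eq_inv_mul]

@[simp] theorem barycenter_singleton {a : ℝ} (ha : 0 < a) (x : 𝔛) :
    barycenter {(a, x)} = x := by
  rw [barycenter_eq_comb (w := ![1]) (u := ![x]), comb_one]
  · exact ⟨fun i => by simp, by simp⟩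
  · simp [ha.ne']

/-- The associativity axiom, freed from normalization and from the order of the entries. -/
theorem barycenter_cons_cons {M : Multiset (ℝ × 𝔛)} (hM : PosWeighted M) {a b : ℝ} (ha : 0 < a)
    (hb : 0 < b) (x y : 𝔛) :
    barycenter ((a, x) ::ₘ (b, y) ::ₘ M)
      = barycenter ((a + b, barycenter {(a, x), (b, y)}) ::ₘ M) := by
  have hab : 0 < a + b := add_pos ha hb
  -- The axiom needs weights of sum one, so everything is divided by the total weight `T`.
  set T := a + b + totalWeight M with hT
  have hT0 : 0 < T := by have := hM.totalWeight_nonneg; positivity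
  set N := scaleWeights T⁻¹ M with hN
  set w : Fin N.toList.length → ℝ := fun i => (N.toList.get i).1
  set u : Fin N.toList.length → 𝔛 := fun i => (N.toList.get i).2
  have hNu : (Finset.univ.val.map fun i => (w i, u i)) = N :=
    (map_univ_toList_get N id).trans (Multiset.map_id N)
  have hNw : ∑ i, w i = totalWeight N := by
    rw [totalWeight, ← map_univ_toList_get N Prod.fst]; rfl
  have hNp : PosWeighted N := hM.scaleWeights (inv_pos.2 hT0)
  have hwp : ∀ i, 0 < w i := fun i => hNp _ (Multiset.mem_toList.1 (List.get_mem _ _))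
  have hNt : totalWeight N = T⁻¹ * totalWeight M := by simp [N]
  have hq : T⁻¹ * totalWeight M + (T⁻¹ * a + T⁻¹ * b) = 1 := by
    field_simp; rw [hT]; ring
  have h1 : IsPosWeights (Fin.snoc (α := fun _ => ℝ) (Fin.snoc (α := fun _ => ℝ) w (T⁻¹ * a)) (T⁻¹ * b)) := by
    constructor
    · intro i
      refine Fin.lastCases ?_ (fun i => ?_) i
      · simp; positivity
      · refine Fin.lastCases ?_ (fun i => ?_) i
        · simp; positivity
        · simpa using hwp i
    · rw [Fin.sum_univ_castSucc]
      simp [Fin.sum_univ_castSucc, hNw, hNt]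
      linarith
  have h2 : IsPosWeights (Fin.snoc (α := fun _ => ℝ) w (T⁻¹ * a + T⁻¹ * b)) := by
    constructor
    · intro i
      refine Fin.lastCases ?_ (fun i => ?_) i
      · simp; positivity
      · simpa using hwp i
    · simp [Fin.sum_univ_castSucc, hNw, hNt]
      linarith
  have key := comb_assoc w (T⁻¹ * a) (T⁻¹ * b) u x y h1
  rw [comb_eq_barycenter h1, comb_eq_barycenter h2, univ_map_snoc, univ_map_snoc, univ_map_snoc,
    hNu] at key
  have h3 : comb ![T⁻¹ * a / (T⁻¹ * a + T⁻¹ * b), T⁻¹ * b / (T⁻¹ * a + T⁻¹ * b)] ![x, y]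
      = barycenter {(a, x), (b, y)} := by
    rw [barycenter_pair ha hb]
    congr 2
    · field_simp
    · congr 1
      field_simp
      ring
  rw [h3] at key
  rw [← barycenter_scaleWeights (c := T⁻¹) (by simp [ha, hb, hM]) (inv_pos.2 hT0),
    ← barycenter_scaleWeights (c := T⁻¹) (M := _ ::ₘ M) (by simp [hab, hM]) (inv_pos.2 hT0)]
  simp only [scaleWeights_cons, ← hN, mul_add]
  -- The outermost `Fin.snoc` holds `y`, so `key` lists the two points in the opposite order.
  rw [← key, Multiset.cons_swap]

/-- Induction on `N`: its head is moved into `M`, the tail is collapsed, and then the two entries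
are merged. The induction hypothesis is used a second time, with the head alone as `M`, to recognize
the merged point as the barycenter of all of `N`. -/
theorem barycenter_add {N : Multiset (ℝ × 𝔛)} (hN : PosWeighted N) (h0 : N ≠ 0)
    {M : Multiset (ℝ × 𝔛)} (hM : PosWeighted M) :
    barycenter (M + N) = barycenter ((totalWeight N, barycenter N) ::ₘ M) := by
  induction N using Multiset.induction generalizing M with
  | empty => exact absurd rfl h0
  | cons p N ih =>
    obtain ⟨a, x⟩ := p
    simp only [posWeighted_cons] at hN
    rcases eq_or_ne N 0 with rfl | hN0
    · simp [hN.1, add_comm M]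
    · have hp := hN.2.totalWeight_pos hN0
      have e : ∀ M : Multiset (ℝ × 𝔛), M + (a, x) ::ₘ N = ((a, x) ::ₘ M) + N := fun M => by
        rw [Multiset.add_cons, Multiset.cons_add]
      have h1 : barycenter ((a, x) ::ₘ N) = barycenter {(totalWeight N, barycenter N), (a, x)} := by
        have := ih hN.2 hN0 (M := {(a, x)}) (by simp [hN.1])
        simpa [Multiset.insert_eq_cons, Multiset.singleton_add] using this
      rw [e, ih hN.2 hN0 (by simp [hN.1, hM]), barycenter_cons_cons hM hp hN.1, h1,
        totalWeight_cons, add_comm a]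

theorem barycenter_cons {M : Multiset (ℝ × 𝔛)} (hM : PosWeighted M) (h0 : M ≠ 0) {a : ℝ}
    (ha : 0 < a) (x : 𝔛) :
    barycenter ((a, x) ::ₘ M) = barycenter {(a, x), (totalWeight M, barycenter M)} := by
  rw [← Multiset.singleton_add, barycenter_add hM h0 (by simp [ha])]
  congr 1
  rw [Multiset.insert_eq_cons, Multiset.cons_eq_cons]
  by_cases h : ((totalWeight M, barycenter M) : ℝ × 𝔛) = (a, x)
  · simp [h]
  · exact Or.inr ⟨h, 0, by simp, by simp⟩

/-- The spare summand `M` is what lets the induction run: the part just peeled off `S` joins it. -/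
theorem barycenter_add_join {S : Multiset (Multiset (ℝ × 𝔛))}
    (hS : ∀ N ∈ S, PosWeighted N ∧ N ≠ 0) {M : Multiset (ℝ × 𝔛)} (hM : PosWeighted M) :
    barycenter (M + S.join) = barycenter (M + S.map fun N => (totalWeight N, barycenter N)) := by
  induction S using Multiset.induction generalizing M with
  | empty => simp
  | cons N S ih =>
    simp only [Multiset.mem_cons, forall_eq_or_imp] at hS
    rw [Multiset.join_cons, Multiset.map_cons, ← add_assoc,
      ih hS.2 (posWeighted_add.2 ⟨hM, hS.1.1⟩), add_right_comm, barycenter_add hS.1.1 hS.1.2,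
      Multiset.add_cons]
    refine posWeighted_add.2 ⟨hM, fun p hp => ?_⟩
    obtain ⟨N', hN', rfl⟩ := Multiset.mem_map.1 hp
    exact (hS.2 N' hN').1.totalWeight_pos (hS.2 N' hN').2

theorem barycenter_join {S : Multiset (Multiset (ℝ × 𝔛))} (hS : ∀ N ∈ S, PosWeighted N ∧ N ≠ 0) :
    barycenter S.join = barycenter (S.map fun N => (totalWeight N, barycenter N)) := by
  simpa using barycenter_add_join hS (M := 0) (by simp [PosWeighted])

theorem dist_barycenter_pair_le {a b : ℝ} (ha : 0 < a) (hb : 0 < b) (x y x' y' : 𝔛) :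
    (a + b) * dist (barycenter {(a, x), (b, y)}) (barycenter {(a, x'), (b, y')})
      ≤ a * dist x x' + b * dist y y' := by
  have hab : 0 < a + b := add_pos ha hb
  rw [barycenter_pair ha hb, barycenter_pair ha hb]
  have := dist_comb_le x y x' y' (a / (a + b)) ⟨by positivity, by rw [div_lt_one hab]; linarith⟩
  calc _ ≤ (a + b) * (a / (a + b) * dist x x' + (1 - a / (a + b)) * dist y y') := by gcongr
    _ = _ := by field_simp; ring

/-- Negative curvature for finitely many points, by splitting off one point at a time. Multiplying
by the total weight avoids renormalizing at each stage. -/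
theorem totalWeight_mul_dist_barycenter_le {ι : Type*} (s : Multiset ι) {w : ι → ℝ} (hs : s ≠ 0)
    (hw : ∀ i ∈ s, 0 < w i) (x y : ι → 𝔛) :
    (s.map w).sum * dist (barycenter (s.map fun i => (w i, x i)))
        (barycenter (s.map fun i => (w i, y i)))
      ≤ (s.map fun i => w i * dist (x i) (y i)).sum := by
  induction s using Multiset.induction with
  | empty => exact absurd rfl hs
  | cons i s ih =>
    simp only [Multiset.mem_cons, forall_eq_or_imp] at hw
    rcases eq_or_ne s 0 with rfl | h0
    · simp [hw.1]
    have hp : ∀ z : ι → 𝔛, PosWeighted (s.map fun i => (w i, z i)) := fun z p hp => by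
      obtain ⟨j, hj, rfl⟩ := Multiset.mem_map.1 hp
      exact hw.2 j hj
    have ht : ∀ z : ι → 𝔛, totalWeight (s.map fun i => (w i, z i)) = (s.map w).sum := fun z => by
      simp [totalWeight, Multiset.map_map]
    have hpos : 0 < (s.map w).sum := by
      rw [← ht x]; exact (hp x).totalWeight_pos (by simpa using h0)
    simp only [Multiset.map_cons, Multiset.sum_cons]
    rw [barycenter_cons (hp x) (by simpa using h0) hw.1,
      barycenter_cons (hp y) (by simpa using h0) hw.1, ht, ht]
    exact (dist_barycenter_pair_le hw.1 hpos _ _ _ _).trans (by gcongr; exact ih h0 hw.2)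

end Barycenter

/-! ### Convex points and the convexification operator -/

section ConvexPoints

variable {𝔛 : Type*} [MetricSpace 𝔛] [ConvexCombinationSpace 𝔛]

/-- A point that is the combination of two copies of itself, for all weights. -/
def IsConvexPoint (z : 𝔛) : Prop :=
  ∀ a b : ℝ, 0 < a → 0 < b → barycenter {(a, z), (b, z)} = z

theorem IsConvexPoint.barycenter_eq {z : 𝔛} (hz : IsConvexPoint z) {M : Multiset (ℝ × 𝔛)}
    (hM : PosWeighted M) (h0 : M ≠ 0) (h : ∀ p ∈ M, p.2 = z) : barycenter M = z := by
  induction M using Multiset.induction with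
  | empty => exact absurd rfl h0
  | cons p M ih =>
    obtain ⟨a, x⟩ := p
    simp only [Multiset.mem_cons, forall_eq_or_imp] at h
    obtain ⟨rfl, h⟩ := h
    rw [posWeighted_cons] at hM
    rcases eq_or_ne M 0 with rfl | hM0
    · simp [hM.1]
    · rw [barycenter_cons hM.2 hM0 hM.1, ih hM.2 hM0 h]
      exact hz _ _ hM.1 (hM.2.totalWeight_pos hM0)

theorem barycenter_cons_cons_self {z : 𝔛} (hz : IsConvexPoint z) {a b : ℝ} (ha : 0 < a)
    (hb : 0 < b) {M : Multiset (ℝ × 𝔛)} (hM : PosWeighted M) :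
    barycenter ((a, z) ::ₘ (b, z) ::ₘ M) = barycenter ((a + b, z) ::ₘ M) := by
  rw [barycenter_cons_cons hM ha hb, hz a b ha hb]

/-- Substituting barycenters for two points. -/
theorem barycenter_pair_barycenter {M N : Multiset (ℝ × 𝔛)} (hM : PosWeighted M)
    (hM0 : totalWeight M = 1) (hN : PosWeighted N) (hN0 : totalWeight N = 1) {a b : ℝ} (ha : 0 < a)
    (hb : 0 < b) :
    barycenter {(a, barycenter M), (b, barycenter N)}
      = barycenter (scaleWeights a M + scaleWeights b N) := by
  have hMne : M ≠ 0 := by rintro rfl; simp at hM0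
  have hNne : N ≠ 0 := by rintro rfl; simp at hN0
  have := barycenter_join (S := {scaleWeights a M, scaleWeights b N}) (by
    simp only [Multiset.insert_eq_cons, Multiset.mem_cons, Multiset.mem_singleton, forall_eq_or_imp,
      forall_eq]
    exact ⟨⟨hM.scaleWeights ha, by simpa [scaleWeights] using hMne⟩,
      hN.scaleWeights hb, by simpa [scaleWeights] using hNne⟩)
  simp only [Multiset.insert_eq_cons, Multiset.join_cons, Multiset.map_cons, Multiset.map_singleton,
    totalWeight_scaleWeights, hM0, hN0, mul_one, barycenter_scaleWeights hM ha,
    barycenter_scaleWeights hN hb] at this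
  rw [Multiset.singleton_join] at this
  exact this.symm

/-- Expansion yields four weighted points, and the two copies of each convex point merge. Thus the
segment from `x` to `y` behaves affinely in its parameter. -/
theorem barycenter_pair_barycenter_pair {x y : 𝔛} (hx : IsConvexPoint x) (hy : IsConvexPoint y)
    {s t : ℝ} (hs : s ∈ Set.Ioo (0 : ℝ) 1) (ht : t ∈ Set.Ioo (0 : ℝ) 1) {a b : ℝ} (ha : 0 < a)
    (hb : 0 < b) :
    barycenter {(a, barycenter {(s, x), (1 - s, y)}), (b, barycenter {(t, x), (1 - t, y)})}
      = barycenter {(a * s + b * t, x), (a * (1 - s) + b * (1 - t), y)} := by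
  have hs1 : 0 < 1 - s := sub_pos.2 hs.2
  have ht1 : 0 < 1 - t := sub_pos.2 ht.2
  have hs0 := hs.1
  have ht0 := ht.1
  rw [barycenter_pair_barycenter (by simp [Multiset.insert_eq_cons, hs1, hs0])
    (by simp [Multiset.insert_eq_cons]) (by simp [Multiset.insert_eq_cons, ht1, ht0])
    (by simp [Multiset.insert_eq_cons]) ha hb]
  simp only [Multiset.insert_eq_cons, scaleWeights_cons, scaleWeights_singleton]
  have e : ((a * s, x) ::ₘ {(a * (1 - s), y)}) + ((b * t, x) ::ₘ {(b * (1 - t), y)})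
      = (a * s, x) ::ₘ (b * t, x) ::ₘ (a * (1 - s), y) ::ₘ {(b * (1 - t), y)} := by
    rw [Multiset.add_cons, Multiset.cons_add, Multiset.singleton_add, Multiset.cons_swap]
  rw [e, barycenter_cons_cons_self hx (by positivity) (by positivity)
    (by simp; constructor <;> positivity), ← Multiset.cons_zero (_, y), Multiset.cons_swap (_, x),
    Multiset.cons_swap (_, x), barycenter_cons_cons_self hy (by positivity) (by positivity)
    (by simp; positivity), Multiset.cons_swap, Multiset.cons_zero]

theorem IsConvexPoint.barycenter_pair {x y : 𝔛} (hx : IsConvexPoint x) (hy : IsConvexPoint y)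
    {a b : ℝ} (ha : 0 < a) (hb : 0 < b) : IsConvexPoint (barycenter {(a, x), (b, y)}) := by
  have hab : 0 < a + b := add_pos ha hb
  set t := a / (a + b)
  have ht : t ∈ Set.Ioo (0 : ℝ) 1 := ⟨by positivity, by rw [div_lt_one hab]; linarith⟩
  have ht0 := ht.1
  have ht1 : 0 < 1 - t := sub_pos.2 ht.2
  rw [ConvexCombinationSpace.barycenter_pair ha hb, comb_pair_eq_barycenter ht]
  intro c d hc hd
  rw [barycenter_pair_barycenter_pair hx hy ht ht hc hd, ← add_mul, ← add_mul,
    ← barycenter_scaleWeights (c := c + d) (M := {(t, x), (1 - t, y)})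
    (by simp [Multiset.insert_eq_cons, ht1, ht0]) (by positivity)]
  simp [Multiset.insert_eq_cons]

theorem isConvexPoint_barycenter {M : Multiset (ℝ × 𝔛)} (hM : PosWeighted M) (h0 : M ≠ 0)
    (h : ∀ p ∈ M, IsConvexPoint p.2) : IsConvexPoint (barycenter M) := by
  induction M using Multiset.induction with
  | empty => exact absurd rfl h0
  | cons p M ih =>
    obtain ⟨a, x⟩ := p
    simp only [Multiset.mem_cons, forall_eq_or_imp] at h
    rw [posWeighted_cons] at hM
    rcases eq_or_ne M 0 with rfl | hM0
    · simpa [hM.1] using h.1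
    · rw [barycenter_cons hM.2 hM0 hM.1]
      exact h.1.barycenter_pair (ih hM.2 hM0 h.2) hM.1 (hM.2.totalWeight_pos hM0)

/-- The combination of `n` copies of `x` with equal weights. -/
def uniformMean (n : ℕ) (x : 𝔛) : 𝔛 := barycenter (Multiset.replicate n ((1 : ℝ), x))

omit [MetricSpace 𝔛] [ConvexCombinationSpace 𝔛] in
theorem totalWeight_replicate (n : ℕ) (p : ℝ × 𝔛) :
    totalWeight (Multiset.replicate n p) = n * p.1 := by simp [totalWeight]

omit [MetricSpace 𝔛] [ConvexCombinationSpace 𝔛] in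
theorem posWeighted_replicate_one (n : ℕ) (x : 𝔛) :
    PosWeighted (Multiset.replicate n ((1 : ℝ), x)) := fun p hp => by
  rw [Multiset.eq_of_mem_replicate hp]; exact one_pos

theorem barycenter_replicate {a : ℝ} (ha : 0 < a) (n : ℕ) (x : 𝔛) :
    barycenter (Multiset.replicate n (a, x)) = uniformMean n x := by
  rw [uniformMean, ← barycenter_scaleWeights (posWeighted_replicate_one n x) ha]
  simp [scaleWeights]

theorem uniformMean_uniformMean (m : ℕ) {n : ℕ} (hn : n ≠ 0) (x : 𝔛) :
    uniformMean m (uniformMean n x) = uniformMean (m * n) x := by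
  have h := barycenter_join (S := Multiset.replicate m (Multiset.replicate n ((1 : ℝ), x)))
    fun N hN => by
      rw [Multiset.eq_of_mem_replicate hN]
      exact ⟨posWeighted_replicate_one n x, by
        rw [← Multiset.card_pos, Multiset.card_replicate]; omega⟩
  rw [Multiset.map_replicate, totalWeight_replicate, mul_one,
    barycenter_replicate (by positivity)] at h
  refine h.symm.trans ?_
  rw [uniformMean]
  congr 1
  rw [Multiset.eq_replicate]
  refine ⟨by simp, fun b hb => ?_⟩
  obtain ⟨s, hs, hb⟩ := Multiset.mem_join.1 hb
  rw [Multiset.eq_of_mem_replicate hs] at hb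
  exact Multiset.eq_of_mem_replicate hb

theorem dist_uniformMean_le {n : ℕ} (hn : n ≠ 0) (x y : 𝔛) :
    dist (uniformMean n x) (uniformMean n y) ≤ dist x y := by
  have h := totalWeight_mul_dist_barycenter_le (Multiset.replicate n ()) (w := fun _ => 1)
    (by rw [← Multiset.card_pos, Multiset.card_replicate]; omega) (fun _ _ => one_pos)
    (fun _ => x) fun _ => y
  simp only [Multiset.map_replicate, Multiset.sum_replicate, nsmul_eq_mul, mul_one, one_mul] at h
  exact le_of_mul_le_mul_left h (by positivity)

theorem tendsto_uniformMean (x : 𝔛) :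
    Tendsto (fun n : ℕ => uniformMean (n + 1) x) atTop (𝓝 (convexify x)) := by
  refine (Classical.choose_spec (exists_convexification x)).congr fun n => ?_
  rw [comb_eq_barycenter ⟨fun i => by positivity, by simp; field_simp⟩,
    ← barycenter_replicate (a := 1 / ((n : ℝ) + 1)) (by positivity)]
  congr 1
  simp [Multiset.map_const']

/-- The `m`-fold mean is nonexpansive, and it sends the means that converge to `K x` to a
subsequence of themselves. -/
theorem uniformMean_convexify {m : ℕ} (hm : m ≠ 0) (x : 𝔛) :
    uniformMean m (convexify x) = convexify x := by
  have hc : Continuous (uniformMean (𝔛 := 𝔛) m) :=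
    (LipschitzWith.of_dist_le_mul (K := 1) fun x y => by simpa using dist_uniformMean_le hm x y).continuous
  have h1 := (hc.tendsto (convexify x)).comp (tendsto_uniformMean x)
  -- The sequence in `tendsto_uniformMean` has `n + 1` copies at index `n`, hence the shift by one.
  have h2 : Tendsto (fun n : ℕ => m * (n + 1) - 1) atTop atTop := by
    refine tendsto_atTop_mono (fun n => ?_) tendsto_id
    have := Nat.le_mul_of_pos_left (n + 1) (Nat.pos_of_ne_zero hm)
    simp only [id]; omega
  refine tendsto_nhds_unique h1 (((tendsto_uniformMean x).comp h2).congr fun n => ?_)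
  have : 0 < m * (n + 1) := by positivity
  simp only [Function.comp_apply]
  rw [uniformMean_uniformMean m n.succ_ne_zero, Nat.sub_add_cancel this]

theorem dist_convexify_le (x y : 𝔛) : dist (convexify x) (convexify y) ≤ dist x y :=
  le_of_tendsto ((tendsto_uniformMean x).dist (tendsto_uniformMean y))
    (Eventually.of_forall fun n => dist_uniformMean_le n.succ_ne_zero x y)

/-- Invariance under uniform means settles natural weights by grouping `p + q` equal copies.
Rational ratios follow, and continuity in the weight reaches all real ones. -/
theorem isConvexPoint_convexify (x : 𝔛) : IsConvexPoint (convexify x) := by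
  set z := convexify x
  have hnat : ∀ p q : ℕ, p ≠ 0 → q ≠ 0 → barycenter {((p : ℝ), z), ((q : ℝ), z)} = z := by
    intro p q hp hq
    have hne : ∀ n : ℕ, n ≠ 0 → Multiset.replicate n ((1 : ℝ), z) ≠ 0 := fun n hn => by
      rw [← Multiset.card_pos, Multiset.card_replicate]; omega
    have h := barycenter_join
      (S := {Multiset.replicate p ((1 : ℝ), z), Multiset.replicate q ((1 : ℝ), z)}) (by
        simp only [Multiset.insert_eq_cons, Multiset.mem_cons, Multiset.mem_singleton,
          forall_eq_or_imp, forall_eq]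
        exact ⟨⟨posWeighted_replicate_one p z, hne p hp⟩, posWeighted_replicate_one q z, hne q hq⟩)
    have e : Multiset.join {Multiset.replicate p ((1 : ℝ), z), Multiset.replicate q ((1 : ℝ), z)}
        = Multiset.replicate (p + q) ((1 : ℝ), z) := by
      rw [Multiset.insert_eq_cons, Multiset.join_cons, Multiset.singleton_join,
        Multiset.replicate_add]
    rw [e, ← uniformMean, uniformMean_convexify (by omega)] at h
    simp only [Multiset.insert_eq_cons, Multiset.map_cons, Multiset.map_singleton,
      totalWeight_replicate, mul_one] at h
    rw [← uniformMean, ← uniformMean, uniformMean_convexify hp, uniformMean_convexify hq] at h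
    exact h.symm
  have hrat : ∀ t ∈ Set.Ioo (0 : ℝ) 1 ∩ Set.range ((↑) : ℚ → ℝ), comb ![t, 1 - t] ![z, z] = z := by
    rintro _ ⟨⟨h0, h1⟩, r, rfl⟩
    norm_cast at h0 h1
    have hp : 0 < r.num := Rat.num_pos.2 h0
    have hq : r.num < r.den := by
      have := Rat.num_div_den r
      rw [← this, div_lt_one (by exact_mod_cast r.den_pos)] at h1
      exact_mod_cast h1
    obtain ⟨p, hpn⟩ := Int.eq_ofNat_of_zero_le hp.le
    have hpq : p < r.den := by omega
    have := hnat p (r.den - p) (by omega) (by omega)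
    rw [barycenter_pair (by exact_mod_cast (by omega : 0 < p))
      (by exact_mod_cast (by omega : 0 < r.den - p)), Nat.cast_sub hpq.le] at this
    have hr : (r : ℝ) = (p : ℝ) / (p + (r.den - p)) := by
      rw [add_sub_cancel, Rat.cast_def, hpn, Int.cast_natCast]
    rw [hr]
    exact this
  intro a b ha hb
  have hab : 0 < a + b := add_pos ha hb
  rw [barycenter_pair ha hb]
  have ht : a / (a + b) ∈ Set.Ioo (0 : ℝ) 1 := ⟨by positivity, by rw [div_lt_one hab]; linarith⟩
  have hcl : a / (a + b) ∈ closure (Set.Ioo (0 : ℝ) 1 ∩ Set.range ((↑) : ℚ → ℝ)) :=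
    Rat.denseRange_cast.open_subset_closure_inter isOpen_Ioo ht
  have hc := ((comb_continuous z z).continuousAt (isOpen_Ioo.mem_nhds ht)).continuousWithinAt
    (s := Set.Ioo (0 : ℝ) 1 ∩ Set.range ((↑) : ℚ → ℝ))
  have := hc.mem_closure (t := {z}) hcl fun t ht => hrat t ht
  simpa using this

end ConvexPoints

end ConvexCombinationSpace

/-- A positive maximum would be attained only in the interior. At its leftmost maximizer `r`, the
midpoint inequality for `r - δ` and `r + δ` makes `r - δ` a maximizer too. -/
theorem ContinuousOn.le_zero_of_midpoint_le {h : ℝ → ℝ} (hc : ContinuousOn h (Set.Icc 0 1))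
    (h0 : h 0 ≤ 0) (h1 : h 1 ≤ 0)
    (hm : ∀ s ∈ Set.Ioo (0 : ℝ) 1, ∀ t ∈ Set.Ioo (0 : ℝ) 1, h ((s + t) / 2) ≤ (h s + h t) / 2)
    {t : ℝ} (ht : t ∈ Set.Icc (0 : ℝ) 1) : h t ≤ 0 := by
  obtain ⟨m, hmI, hmax⟩ := isCompact_Icc.exists_isMaxOn ⟨t, ht⟩ hc
  refine (hmax ht).trans ?_
  by_contra! hpos
  have hK : IsCompact (Set.Icc (0 : ℝ) 1 ∩ h ⁻¹' {h m}) :=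
    isCompact_Icc.of_isClosed_subset (hc.preimage_isClosed_of_isClosed isClosed_Icc isClosed_singleton)
      Set.inter_subset_left
  obtain ⟨r, ⟨hrI, hr⟩, hmin⟩ := hK.exists_isLeast ⟨m, hmI, rfl⟩
  rw [Set.mem_preimage, Set.mem_singleton_iff] at hr
  have hr0 : 0 < r := lt_of_le_of_ne hrI.1 fun e => by rw [← e] at hr; linarith
  have hr1 : r < 1 := lt_of_le_of_ne hrI.2 fun e => by rw [e] at hr; linarith
  obtain ⟨δ, hδ, hδr, hδ1⟩ : ∃ δ : ℝ, 0 < δ ∧ δ < r ∧ δ < 1 - r := by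
    obtain ⟨δ, hδ, h⟩ := exists_between (lt_min hr0 (sub_pos.2 hr1))
    exact ⟨δ, hδ, h.trans_le (min_le_left _ _), h.trans_le (min_le_right _ _)⟩
  have h2 := hm (r - δ) ⟨by linarith, by linarith⟩ (r + δ) ⟨by linarith, by linarith⟩
  rw [show (r - δ + (r + δ)) / 2 = r by ring, hr] at h2
  have h3 : h (r + δ) ≤ h m := hmax (⟨by linarith, by linarith⟩ : r + δ ∈ Set.Icc (0 : ℝ) 1)
  have h4 : h (r - δ) ≤ h m := hmax (⟨by linarith, by linarith⟩ : r - δ ∈ Set.Icc (0 : ℝ) 1)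
  have := hmin ⟨⟨by linarith, by linarith⟩, show h (r - δ) = h m by linarith⟩
  linarith

namespace ConvexCombinationSpace

/-! ### Finite Jensen inequality for midpoint convex functions -/

section Jensen

variable {𝔛 : Type*} [MetricSpace 𝔛] [ConvexCombinationSpace 𝔛]

namespace MidpointConvex

variable {φ : 𝔛 → ℝ}

theorem apply_half_le (hφ : MidpointConvex φ) (x y : 𝔛) :
    φ (comb ![(1 / 2 : ℝ), 1 - 1 / 2] ![x, y]) ≤ (φ x + φ y) / 2 := by
  have := hφ x y
  rwa [show (1 - 1 / 2 : ℝ) = 1 / 2 by norm_num]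

/-- A mean of `2 ^ n` copies is an iterated midpoint of a point with itself. -/
theorem uniformMean_le (hφ : MidpointConvex φ) (n : ℕ) (x : 𝔛) :
    φ (uniformMean (2 ^ n) x) ≤ φ x := by
  induction n with
  | zero => simp [uniformMean, Multiset.replicate_one]
  | succ n ih =>
    rw [pow_succ', ← uniformMean_uniformMean 2 (by positivity)]
    set y := uniformMean (2 ^ n) x
    have h : uniformMean 2 y = comb ![(1 / 2 : ℝ), 1 - 1 / 2] ![y, y] := by
      have := barycenter_pair one_pos one_pos y y
      rw [one_add_one_eq_two] at this
      exact this
    rw [h]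
    have := hφ.apply_half_le y y
    linarith

theorem convexify_le (hφ : MidpointConvex φ) (hc : Continuous φ) (x : 𝔛) :
    φ (convexify x) ≤ φ x := by
  have h2 : Tendsto (fun n : ℕ => 2 ^ n - 1) atTop atTop :=
    tendsto_atTop_mono (fun n => Nat.le_sub_one_of_lt n.lt_two_pow_self) tendsto_id
  refine le_of_tendsto ((hc.tendsto _).comp ((tendsto_uniformMean x).comp h2))
    (Eventually.of_forall fun n => ?_)
  simp only [Function.comp_apply]
  rw [Nat.sub_add_cancel Nat.one_le_two_pow]
  exact hφ.uniformMean_le n x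

theorem comb_pair_le (hφ : MidpointConvex φ) (hc : Continuous φ) {x y : 𝔛} (hx : IsConvexPoint x)
    (hy : IsConvexPoint y) {t : ℝ} (ht : t ∈ Set.Ioo (0 : ℝ) 1) :
    φ (comb ![t, 1 - t] ![x, y]) ≤ t * φ x + (1 - t) * φ y := by
  classical
  -- The segment from `y` to `x`, closed up at its ends. Continuity there holds because `y` is a
  -- combination of itself: negative curvature bounds the distance of `c s` from `y` by `s * dist x
  -- y`, and likewise at `x`.
  set c : ℝ → 𝔛 := fun t => if t ≤ 0 then y else if 1 ≤ t then x else comb ![t, 1 - t] ![x, y]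
  have hcI : ∀ t ∈ Set.Ioo (0 : ℝ) 1, c t = comb ![t, 1 - t] ![x, y] := fun t ht => by
    simp [c, ht.1.not_ge, ht.2.not_ge]
  have hself : ∀ z : 𝔛, IsConvexPoint z → ∀ t ∈ Set.Ioo (0 : ℝ) 1, comb ![t, 1 - t] ![z, z] = z :=
    fun z hz t ht => by rw [comb_pair_eq_barycenter ht]; exact hz _ _ ht.1 (sub_pos.2 ht.2)
  have hcc : ContinuousOn c (Set.Icc 0 1) := by
    intro t ht
    rcases ht.1.eq_or_lt with rfl | h0
    · refine (tendsto_iff_dist_tendsto_zero.2 ?_)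
      refine squeeze_zero' (g := fun s => s * dist x y) (Eventually.of_forall fun _ => dist_nonneg)
        ?_ ((continuous_id.mul continuous_const).tendsto' 0 0 (by simp) |>.mono_left inf_le_left)
      filter_upwards [self_mem_nhdsWithin,
        mem_nhdsWithin_of_mem_nhds (Iio_mem_nhds (zero_lt_one (α := ℝ)))] with s hs hs1
      have e : c 0 = y := by simp [c]
      rcases hs.1.eq_or_lt with rfl | hs0
      · simp
      · rw [hcI s ⟨hs0, hs1⟩, e]
        have := dist_comb_le x y y y s ⟨hs0, hs1⟩
        rw [hself y hy s ⟨hs0, hs1⟩] at this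
        simpa using this
    rcases ht.2.eq_or_lt with rfl | h1
    · refine (tendsto_iff_dist_tendsto_zero.2 ?_)
      refine squeeze_zero' (g := fun s => (1 - s) * dist y x)
        (Eventually.of_forall fun _ => dist_nonneg) ?_
        (((continuous_const.sub continuous_id).mul continuous_const).tendsto' 1 0 (by simp)
          |>.mono_left inf_le_left)
      filter_upwards [self_mem_nhdsWithin,
        mem_nhdsWithin_of_mem_nhds (Ioi_mem_nhds (zero_lt_one (α := ℝ)))] with s hs hs0
      have e : c 1 = x := by simp [c]
      rcases hs.2.eq_or_lt with rfl | hs1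
      · simp
      · rw [hcI s ⟨hs0, hs1⟩, e]
        have := dist_comb_le x y x x s ⟨hs0, hs1⟩
        rw [hself x hx s ⟨hs0, hs1⟩] at this
        simpa using this
    · have := (comb_continuous x y).continuousAt (isOpen_Ioo.mem_nhds ⟨h0, h1⟩)
      refine (this.congr ?_).continuousWithinAt
      filter_upwards [isOpen_Ioo.mem_nhds (⟨h0, h1⟩ : t ∈ Set.Ioo (0 : ℝ) 1)] with s hs
      exact (hcI s hs).symm
  -- Subtracting the chord leaves a function that vanishes at both ends and inherits the midpoint
  -- inequality.
  set h : ℝ → ℝ := fun t => φ (c t) - (t * φ x + (1 - t) * φ y)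
  have key := ContinuousOn.le_zero_of_midpoint_le (h := h)
    ((hc.comp_continuousOn hcc).sub (by fun_prop)) (by simp [h, c])
    (by simp [h, c, (zero_lt_one (α := ℝ)).not_ge])
    (fun s hs t ht => by
      have hst : (s + t) / 2 ∈ Set.Ioo (0 : ℝ) 1 :=
        ⟨by linarith [hs.1, ht.1], by linarith [hs.2, ht.2]⟩
      have := hφ.apply_half_le (c s) (c t)
      have e : comb ![(1 / 2 : ℝ), 1 - 1 / 2] ![c s, c t] = c ((s + t) / 2) := by
        rw [comb_pair_eq_barycenter ⟨by norm_num, by norm_num⟩, hcI s hs, hcI t ht, hcI _ hst,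
          comb_pair_eq_barycenter hs, comb_pair_eq_barycenter ht, comb_pair_eq_barycenter hst,
          barycenter_pair_barycenter_pair hx hy hs ht (by norm_num) (by norm_num)]
        congr 4 <;> ring
      rw [e] at this
      simp only [h]
      linarith) (Set.Ioo_subset_Icc_self ht)
  simp only [h, hcI t ht] at key
  linarith

theorem totalWeight_mul_le (hφ : MidpointConvex φ) (hc : Continuous φ) {M : Multiset (ℝ × 𝔛)}
    (hM : PosWeighted M) (h0 : M ≠ 0) (h : ∀ p ∈ M, IsConvexPoint p.2) :
    totalWeight M * φ (barycenter M) ≤ (M.map fun p => p.1 * φ p.2).sum := by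
  induction M using Multiset.induction with
  | empty => exact absurd rfl h0
  | cons p M ih =>
    obtain ⟨a, x⟩ := p
    simp only [Multiset.mem_cons, forall_eq_or_imp] at h
    rw [posWeighted_cons] at hM
    rcases eq_or_ne M 0 with rfl | hM0
    · simp [hM.1]
    have hT := hM.2.totalWeight_pos hM0
    have ha : 0 < a := hM.1
    have haT : 0 < a + totalWeight M := add_pos ha hT
    have := hφ.comb_pair_le hc h.1 (isConvexPoint_barycenter hM.2 hM0 h.2)
      (t := a / (a + totalWeight M)) ⟨by positivity, by rw [div_lt_one haT]; linarith⟩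
    rw [barycenter_cons hM.2 hM0 ha, totalWeight_cons, barycenter_pair ha hT, Multiset.map_cons,
      Multiset.sum_cons]
    calc _ ≤ (a + totalWeight M) * (a / (a + totalWeight M) * φ x
            + (1 - a / (a + totalWeight M)) * φ (barycenter M)) := by gcongr
      _ = a * φ x + totalWeight M * φ (barycenter M) := by field_simp; ring
      _ ≤ _ := by gcongr; exact ih hM.2 hM0 h.2

end MidpointConvex

end Jensen

/-! ### Barycenters of finite families: regrouping and measurability -/

section FinsetBarycenter

variable {𝔛 : Type*} [MetricSpace 𝔛] [ConvexCombinationSpace 𝔛] {ι κ : Type*}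

open Classical in
/-- The barycenter of a finite family; the entries whose weight is not positive are left out. -/
def finsetBarycenter (s : Finset ι) (w : ι → ℝ) (x : ι → 𝔛) : 𝔛 :=
  barycenter ((s.filter fun i => 0 < w i).val.map fun i => (w i, x i))

omit [MetricSpace 𝔛] [ConvexCombinationSpace 𝔛] in
theorem posWeighted_filter_map (s : Finset ι) (w : ι → ℝ) [DecidablePred fun i => 0 < w i]
    (x : ι → 𝔛) : PosWeighted ((s.filter fun i => 0 < w i).val.map fun i => (w i, x i)) := by
  intro p hp
  obtain ⟨i, hi, rfl⟩ := Multiset.mem_map.1 hp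
  exact (Finset.mem_filter.1 hi).2

omit [MetricSpace 𝔛] [ConvexCombinationSpace 𝔛] in
theorem sum_filter_pos_mul {s : Finset ι} {w : ι → ℝ} [DecidablePred fun i => 0 < w i]
    (hw : ∀ i ∈ s, 0 ≤ w i) (g : ι → ℝ) :
    ∑ i ∈ s.filter (fun i => 0 < w i), w i * g i = ∑ i ∈ s, w i * g i :=
  Finset.sum_filter_of_ne fun i hi h => (hw i hi).lt_of_ne fun e => h (by rw [← e, zero_mul])

omit [MetricSpace 𝔛] [ConvexCombinationSpace 𝔛] in
theorem sum_filter_pos {s : Finset ι} {w : ι → ℝ} [DecidablePred fun i => 0 < w i]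
    (hw : ∀ i ∈ s, 0 ≤ w i) : ∑ i ∈ s.filter (fun i => 0 < w i), w i = ∑ i ∈ s, w i := by
  simpa using sum_filter_pos_mul hw fun _ => 1

theorem combFinset_eq_finsetBarycenter {s : Finset ι} {w : ι → ℝ} (hw : ∀ i ∈ s, 0 ≤ w i)
    (h1 : ∑ i ∈ s, w i = 1) (x : ι → 𝔛) : combFinset s w x = finsetBarycenter s w x := by
  classical
  set t := s.filter fun i => 0 < w i
  have hsum : ∑ k : Fin t.card, w (t.equivFin.symm k) = 1 := by
    rw [Equiv.sum_comp t.equivFin.symm fun i : t => w i, Finset.sum_coe_sort t w, sum_filter_pos hw, h1]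
  have h := comb_eq_barycenter (w := fun k : Fin t.card => w (t.equivFin.symm k))
    ⟨fun k => (Finset.mem_filter.1 (t.equivFin.symm k).2).2, hsum⟩
    fun k => x (t.equivFin.symm k)
  have e : Finset.univ.val.map (fun k : Fin t.card => (w (t.equivFin.symm k), x (t.equivFin.symm k)))
      = t.val.map fun i => (w i, x i) := by
    have h1 := Multiset.map_univ_val_equiv t.equivFin.symm
    have h2 := congrArg (Multiset.map fun i : t => (w i, x i)) h1
    rw [Multiset.map_map] at h2
    refine h2.trans ?_
    have h3 : (Finset.univ : Finset t).val.map Subtype.val = t.val := by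
      rw [Finset.univ_eq_attach]
      exact Multiset.attach_map_val _
    conv_rhs => rw [← h3]
    rw [Multiset.map_map]
    rfl
  rw [e] at h
  unfold combFinset finsetBarycenter
  convert h

theorem dist_finsetBarycenter_le {s : Finset ι} {w : ι → ℝ} (hw : ∀ i ∈ s, 0 ≤ w i)
    (h1 : ∑ i ∈ s, w i = 1) (x y : ι → 𝔛) :
    dist (finsetBarycenter s w x) (finsetBarycenter s w y) ≤ ∑ i ∈ s, w i * dist (x i) (y i) := by
  classical
  set t := s.filter fun i => 0 < w i
  have hsum : ∑ i ∈ t, w i = 1 := by rw [sum_filter_pos hw, h1]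
  have ht : t.val ≠ 0 := fun h => by
    rw [Finset.val_eq_zero] at h; rw [h] at hsum; simp at hsum
  have := totalWeight_mul_dist_barycenter_le t.val ht (w := w)
    (fun i hi => (Finset.mem_filter.1 hi).2) x y
  change (∑ i ∈ t, w i) * _ ≤ ∑ i ∈ t, w i * dist (x i) (y i) at this
  rw [hsum, one_mul, sum_filter_pos_mul hw] at this
  unfold finsetBarycenter
  convert this

theorem MidpointConvex.finsetBarycenter_le {φ : 𝔛 → ℝ} (hφ : MidpointConvex φ) (hc : Continuous φ)
    {s : Finset ι} {w : ι → ℝ} (hw : ∀ i ∈ s, 0 ≤ w i) (h1 : ∑ i ∈ s, w i = 1) {x : ι → 𝔛}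
    (hx : ∀ i, IsConvexPoint (x i)) : φ (finsetBarycenter s w x) ≤ ∑ i ∈ s, w i * φ (x i) := by
  classical
  set t := s.filter fun i => 0 < w i
  have hsum : ∑ i ∈ t, w i = 1 := by rw [sum_filter_pos hw, h1]
  have ht : t.val ≠ 0 := fun h => by
    rw [Finset.val_eq_zero] at h; rw [h] at hsum; simp at hsum
  have := hφ.totalWeight_mul_le hc (posWeighted_filter_map s w x) (by
    rwa [ne_eq, Multiset.map_eq_zero]) fun p hp => by
    obtain ⟨i, -, rfl⟩ := Multiset.mem_map.1 hp
    exact hx i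
  rw [totalWeight, Multiset.map_map, Multiset.map_map] at this
  change (∑ i ∈ t, w i) * _ ≤ ∑ i ∈ t, w i * φ (x i) at this
  rw [hsum, one_mul, sum_filter_pos_mul hw] at this
  unfold finsetBarycenter
  convert this

-- Each fibre of positive weight is a multiset of copies of one convex point, so its barycenter is
-- that point. Without convexity of the points, equal entries could not be merged.
open Classical in
theorem finsetBarycenter_fiberwise {s : Finset ι} {t : Finset κ} {f : ι → κ}
    (hf : ∀ i ∈ s, f i ∈ t) {w : ι → ℝ} (hw : ∀ i ∈ s, 0 ≤ w i) {z : κ → 𝔛}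
    (hz : ∀ k, IsConvexPoint (z k)) :
    finsetBarycenter s w (fun i => z (f i))
      = finsetBarycenter t (fun k => ∑ i ∈ s with f i = k, w i) z := by
  set W : κ → ℝ := fun k => ∑ i ∈ s with f i = k, w i
  set s' := s.filter fun i => 0 < w i
  set t' := t.filter fun k => 0 < W k
  have hmaps : ∀ i ∈ s', f i ∈ t' := fun i hi => by
    rw [Finset.mem_filter] at hi ⊢
    refine ⟨hf i hi.1, hi.2.trans_le ?_⟩
    exact Finset.single_le_sum (f := w) (fun j hj => hw j (Finset.mem_filter.1 hj).1)
      (Finset.mem_filter.2 ⟨hi.1, rfl⟩)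
  set F : κ → Multiset (ℝ × 𝔛) := fun k => (s'.filter fun i => f i = k).val.map fun i => (w i, z (f i))
  have hFW : ∀ k, totalWeight (F k) = W k := fun k => by
    have : totalWeight (F k) = ∑ i ∈ s' with f i = k, w i := by
      simp only [F, totalWeight, Multiset.map_map]; rfl
    rw [this]
    simp only [s', W]
    rw [Finset.filter_comm, sum_filter_pos fun i hi => hw i (Finset.mem_filter.1 hi).1]
  have hFpos : ∀ k, PosWeighted (F k) := fun k p hp => by
    obtain ⟨i, hi, rfl⟩ := Multiset.mem_map.1 hp
    exact (Finset.mem_filter.1 (Finset.mem_filter.1 hi).1).2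
  have hFne : ∀ k ∈ t', F k ≠ 0 := fun k hk h => by
    have := (Finset.mem_filter.1 hk).2
    rw [← hFW, h] at this
    simp at this
  have hj := barycenter_join (S := t'.val.map F) fun N hN => by
    obtain ⟨k, hk, rfl⟩ := Multiset.mem_map.1 hN
    exact ⟨hFpos k, hFne k hk⟩
  have e1 : (t'.val.map F).join = s'.val.map fun i => (w i, z (f i)) := by
    have h := Finset.sum_fiberwise_of_maps_to hmaps
      fun i => ({(w i, z (f i))} : Multiset (ℝ × 𝔛))
    have hs : ∀ r : Finset ι, ∑ i ∈ r, ({(w i, z (f i))} : Multiset (ℝ × 𝔛))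
        = r.val.map fun i => (w i, z (f i)) := fun r => by
      rw [← Multiset.sum_map_singleton (r.val.map _), Multiset.map_map]; rfl
    simp only [hs] at h
    exact h
  have e2 : (t'.val.map F).map (fun N => (totalWeight N, barycenter N))
      = t'.val.map fun k => (W k, z k) := by
    rw [Multiset.map_map]
    refine Multiset.map_congr rfl fun k hk => ?_
    simp only [Function.comp_apply]
    rw [hFW, (hz k).barycenter_eq (hFpos k) (hFne k hk)]
    intro p hp
    obtain ⟨i, hi, rfl⟩ := Multiset.mem_map.1 hp
    exact congrArg z (Finset.mem_filter.1 hi).2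
  rw [e1, e2] at hj
  exact hj

theorem continuousOn_comb_pair :
    ContinuousOn (fun p : ℝ × 𝔛 × 𝔛 => comb ![p.1, 1 - p.1] ![p.2.1, p.2.2])
      (Set.Ioo 0 1 ×ˢ Set.univ) := by
  rintro ⟨t, x, y⟩ ⟨ht, -⟩
  refine ContinuousAt.continuousWithinAt (tendsto_iff_dist_tendsto_zero.2 ?_)
  have hI : ∀ᶠ p : ℝ × 𝔛 × 𝔛 in 𝓝 (t, x, y), p.1 ∈ Set.Ioo (0 : ℝ) 1 :=
    continuous_fst.continuousAt.eventually (isOpen_Ioo.mem_nhds ht)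
  have h1 : Tendsto (fun p : ℝ × 𝔛 × 𝔛 => dist (comb ![p.1, 1 - p.1] ![x, y])
      (comb ![t, 1 - t] ![x, y])) (𝓝 (t, x, y)) (𝓝 0) :=
    (tendsto_iff_dist_tendsto_zero.1
      ((comb_continuous x y).continuousAt (isOpen_Ioo.mem_nhds ht))).comp continuous_fst.continuousAt
  have h2 : Tendsto (fun p : ℝ × 𝔛 × 𝔛 => dist p.2.1 x + dist p.2.2 y) (𝓝 (t, x, y)) (𝓝 0) :=
    Continuous.tendsto' (by fun_prop) _ _ (by simp)
  refine squeeze_zero' (Eventually.of_forall fun _ => dist_nonneg) ?_ (by simpa using h2.add h1)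
  filter_upwards [hI] with p hp
  refine (dist_triangle _ (comb ![p.1, 1 - p.1] ![x, y]) _).trans (add_le_add_left ?_ _)
  refine (dist_comb_le p.2.1 p.2.2 x y p.1 hp).trans (add_le_add ?_ ?_)
  · exact mul_le_of_le_one_left dist_nonneg hp.2.le
  · exact mul_le_of_le_one_left dist_nonneg (by linarith [hp.1])

/-- Adding an index amounts to a two-point combination, which is jointly continuous in weight and
points, so measurability propagates by induction. -/
theorem measurable_finsetBarycenter [SecondCountableTopology 𝔛] [MeasurableSpace 𝔛] [BorelSpace 𝔛]
    {Ω : Type*} [MeasurableSpace Ω] (s : Finset ι) {w : ι → Ω → ℝ} (hw : ∀ i, Measurable (w i))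
    (x : ι → 𝔛) : Measurable fun ω => finsetBarycenter s (fun i => w i ω) x := by
  classical
  induction s using Finset.induction with
  | empty => simp only [finsetBarycenter, Finset.filter_empty, Finset.empty_val, Multiset.map_zero]
             exact measurable_const
  | insert i s hi ih =>
    -- The default value is used when `i` alone has positive weight: the ratio is then 1 and the
    -- barycenter is `x i`.
    set g : ℝ × 𝔛 × 𝔛 → 𝔛 := (Set.Ioo (0 : ℝ) 1 ×ˢ (Set.univ : Set (𝔛 × 𝔛))).piecewise
      (fun p => comb ![p.1, 1 - p.1] ![p.2.1, p.2.2]) fun p => p.2.1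
    have hg : Measurable g := continuousOn_comb_pair.measurable_piecewise (by fun_prop)
      (measurableSet_Ioo.prod MeasurableSet.univ)
    -- Weights may be negative at some `ω`. The truncation gives the total of exactly the entries
    -- that are kept.
    set T : Ω → ℝ := fun ω => ∑ j ∈ s, max (w j ω) 0
    have hT : Measurable T := Finset.measurable_sum _ fun j _ => (hw j).max measurable_const
    have e : (fun ω => finsetBarycenter (insert i s) (fun i => w i ω) x) = fun ω =>
        if 0 < w i ω then
          g (w i ω / (w i ω + T ω), x i, finsetBarycenter s (fun i => w i ω) x)
        else finsetBarycenter s (fun i => w i ω) x := by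
      funext ω
      split_ifs with h
      · set M := (s.filter fun j => 0 < w j ω).val.map fun j => (w j ω, x j)
        have hM : PosWeighted M := posWeighted_filter_map s (fun j => w j ω) x
        have hMT : totalWeight M = T ω := by
          have : totalWeight M = ∑ j ∈ s with 0 < w j ω, w j ω := by
            simp only [M, totalWeight, Multiset.map_map]; rfl
          rw [this, Finset.sum_filter]
          refine Finset.sum_congr rfl fun j _ => ?_
          split_ifs with hj
          · exact (max_eq_left hj.le).symm
          · exact (max_eq_right (not_lt.1 hj)).symm
        have h1 : finsetBarycenter (insert i s) (fun i => w i ω) x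
            = barycenter ((w i ω, x i) ::ₘ M) := by
          unfold finsetBarycenter
          rw [Finset.filter_insert, if_pos h, Finset.insert_val_of_notMem (by simp [hi]),
            Multiset.map_cons]
        have h2 : finsetBarycenter s (fun i => w i ω) x = barycenter M := rfl
        rw [h1, h2, ← hMT]
        rcases eq_or_ne M 0 with h0 | h0
        · rw [h0]
          simp [g, h, h.ne']
        · have hp := hM.totalWeight_pos h0
          have hpp := add_pos h hp
          rw [barycenter_cons hM h0 h, barycenter_pair h hp]
          simp only [g]
          rw [Set.piecewise_eq_of_mem]
          exact ⟨⟨by positivity, by rw [div_lt_one hpp]; linarith⟩, trivial⟩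
      · unfold finsetBarycenter
        rw [Finset.filter_insert, if_neg h]
    rw [e]
    refine Measurable.ite (measurableSet_lt measurable_const (hw i)) (hg.comp ?_) ih
    exact ((hw i).div ((hw i).add hT)).prodMk (measurable_const.prodMk ih)

end FinsetBarycenter

end ConvexCombinationSpace

/-! ### Conditional probabilities of the values of a simple function -/

section CondProb

variable {Ω β : Type*} {𝒢 ℱ : MeasurableSpace Ω}

/-- The conditional probability of `{W = b}`. -/
def condProbEq (𝒢 : MeasurableSpace Ω) {ℱ : MeasurableSpace Ω} (P : Measure Ω) (W : SimpleFunc Ω β) (b : β) :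
    Ω → ℝ :=
  P[(W ⁻¹' {b}).indicator (fun _ => (1 : ℝ)) | 𝒢]

theorem condExp_comp_simpleFunc (P : Measure Ω) [IsProbabilityMeasure P] (W : SimpleFunc Ω β) (f : β → ℝ) :
    P[fun ω => f (W ω) | 𝒢] =ᵐ[P] fun ω => ∑ b ∈ W.range, condProbEq 𝒢 P W b ω * f b := by
  classical
  have h1 : (fun ω => f (W ω))
      = ∑ b ∈ W.range, f b • (W ⁻¹' {b}).indicator (fun _ => (1 : ℝ)) := by
    funext ω
    rw [Finset.sum_apply, Finset.sum_eq_single_of_mem (W ω) (W.mem_range_self ω)]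
    · simp
    · intro b _ hb
      simp [Set.indicator, hb.symm]
  have hint : ∀ b, Integrable ((W ⁻¹' {b}).indicator (fun _ => (1 : ℝ))) P := fun b =>
    (integrable_const 1).indicator (W.measurableSet_fiber b)
  have h3 : ∀ᵐ ω ∂P, ∀ b ∈ W.range,
      (P[f b • (W ⁻¹' {b}).indicator (fun _ => (1 : ℝ)) | 𝒢]) ω = condProbEq 𝒢 P W b ω * f b :=
    (ae_ball_iff W.range.countable_toSet).2 fun b _ => by
      filter_upwards [condExp_smul (μ := P) (f b) ((W ⁻¹' {b}).indicator (fun _ => (1 : ℝ))) 𝒢] with ω hω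
      rw [hω]
      simp [condProbEq, mul_comm]
  rw [h1]
  filter_upwards [condExp_finsetSum (μ := P) (s := W.range)
    (f := fun b => f b • (W ⁻¹' {b}).indicator (fun _ => (1 : ℝ)))
    (fun b _ => (hint b).smul (f b)) 𝒢, h3] with ω h2 h3
  rw [h2, Finset.sum_apply]
  exact Finset.sum_congr rfl h3

theorem condProbEq_nonneg (P : Measure Ω) (W : SimpleFunc Ω β) :
    ∀ᵐ ω ∂P, ∀ b ∈ W.range, 0 ≤ condProbEq 𝒢 P W b ω :=
  (ae_ball_iff W.range.countable_toSet).2 fun _ _ =>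
    condExp_nonneg (Eventually.of_forall fun ω => Set.indicator_nonneg (fun _ _ => zero_le_one) ω)

theorem sum_condProbEq (h𝒢 : 𝒢 ≤ ℱ) (P : Measure Ω) [IsProbabilityMeasure P] (W : SimpleFunc Ω β) :
    ∀ᵐ ω ∂P, ∑ b ∈ W.range, condProbEq 𝒢 P W b ω = 1 := by
  have := condExp_comp_simpleFunc (𝒢 := 𝒢) P W fun _ => 1
  rw [condExp_const h𝒢] at this
  filter_upwards [this] with ω hω
  simpa using hω.symm

open Classical in
theorem condProbEq_eq_sum_fiber (P : Measure Ω) [IsProbabilityMeasure P] {γ : Type*} (W : SimpleFunc Ω β)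
    (Z : SimpleFunc Ω γ) {f : β → γ} (hf : ∀ ω, Z ω = f (W ω)) :
    ∀ᵐ ω ∂P, ∀ c ∈ Z.range,
      condProbEq 𝒢 P Z c ω = ∑ b ∈ W.range with f b = c, condProbEq 𝒢 P W b ω := by
  refine (ae_ball_iff Z.range.countable_toSet).2 fun c _ => ?_
  have := condExp_comp_simpleFunc (𝒢 := 𝒢) P W fun b => if f b = c then 1 else 0
  have e : (fun ω => if f (W ω) = c then (1 : ℝ) else 0)
      = (Z ⁻¹' {c}).indicator (fun _ => (1 : ℝ)) := by
    funext ω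
    simp [Set.indicator, hf]
  rw [e] at this
  filter_upwards [this] with ω hω
  rw [condProbEq, hω, Finset.sum_filter]
  simp

end CondProb

namespace ConvexCombinationSpace

/-! ### Conditional expectations of simple random elements -/

section CondExpSimple

variable {𝔛 : Type*} [MetricSpace 𝔛] [ConvexCombinationSpace 𝔛]
  {Ω : Type*} {𝒢 ℱ : MeasurableSpace Ω}

theorem finsetBarycenter_congr {ι : Type*} {s : Finset ι} {w w' : ι → ℝ} (h : ∀ i ∈ s, w i = w' i)
    (x : ι → 𝔛) : finsetBarycenter s w x = finsetBarycenter s w' x := by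
  classical
  unfold finsetBarycenter
  have e : (s.filter fun i => 0 < w i) = s.filter fun i => 0 < w' i :=
    Finset.filter_congr fun i hi => by rw [h i hi]
  rw [← e]
  exact congrArg barycenter <| Multiset.map_congr rfl fun i hi => by rw [h i (Finset.mem_filter.1 hi).1]

theorem condExpSimple_ae_eq (h𝒢 : 𝒢 ≤ ℱ) (P : Measure Ω) [IsProbabilityMeasure P] (Z : SimpleFunc Ω 𝔛) :
    condExpSimple 𝒢 P Z =ᵐ[P]
      fun ω => finsetBarycenter Z.range (fun x => condProbEq 𝒢 P Z x ω) convexify := by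
  filter_upwards [condProbEq_nonneg (𝒢 := 𝒢) P Z, sum_condProbEq h𝒢 P Z] with ω h0 h1
  exact combFinset_eq_finsetBarycenter h0 h1 _

/-- Allows E(Z|𝒢) to be computed over any finer simple `W`. Two elements can thus be expressed with
the same weights, those of their pair, and compared term by term. -/
theorem condExpSimple_ae_eq_of_comp (h𝒢 : 𝒢 ≤ ℱ) (P : Measure Ω) [IsProbabilityMeasure P]
    {β : Type*} (W : SimpleFunc Ω β) (Z : SimpleFunc Ω 𝔛) {f : β → 𝔛} (hf : ∀ ω, Z ω = f (W ω)) :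
    condExpSimple 𝒢 P Z =ᵐ[P]
      fun ω => finsetBarycenter W.range (fun b => condProbEq 𝒢 P W b ω)
        fun b => convexify (f b) := by
  filter_upwards [condExpSimple_ae_eq h𝒢 P Z, condProbEq_nonneg (𝒢 := 𝒢) P W,
    condProbEq_eq_sum_fiber (𝒢 := 𝒢) P W Z hf] with ω h1 h2 h3
  rw [h1, finsetBarycenter_congr h3, finsetBarycenter_fiberwise (t := Z.range) (f := f) ?_ h2
    isConvexPoint_convexify]
  intro b hb
  obtain ⟨ω', rfl⟩ := SimpleFunc.mem_range.1 hb
  rw [← hf]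
  exact Z.mem_range_self ω'

theorem dist_condExpSimple_le (h𝒢 : 𝒢 ≤ ℱ) (P : Measure Ω) [IsProbabilityMeasure P]
    (Z Z' : SimpleFunc Ω 𝔛) :
    ∀ᵐ ω ∂P, dist (condExpSimple 𝒢 P Z ω) (condExpSimple 𝒢 P Z' ω)
      ≤ (P[fun ω => dist (Z ω) (Z' ω) | 𝒢]) ω := by
  filter_upwards [condExpSimple_ae_eq_of_comp h𝒢 P (Z.pair Z') Z (f := Prod.fst) fun _ => rfl,
    condExpSimple_ae_eq_of_comp h𝒢 P (Z.pair Z') Z' (f := Prod.snd) fun _ => rfl,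
    condProbEq_nonneg (𝒢 := 𝒢) P (Z.pair Z'), sum_condProbEq h𝒢 P (Z.pair Z'),
    condExp_comp_simpleFunc (𝒢 := 𝒢) P (Z.pair Z') fun p => dist p.1 p.2] with ω h1 h2 h3 h4 h5
  rw [h1, h2]
  refine ((dist_finsetBarycenter_le h3 h4 _ _).trans (Finset.sum_le_sum fun b hb => ?_)).trans_eq
    h5.symm
  exact mul_le_mul_of_nonneg_left (dist_convexify_le _ _) (h3 b hb)

theorem MidpointConvex.condExpSimple_le {φ : 𝔛 → ℝ} (hφ : MidpointConvex φ) (hc : Continuous φ)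
    (h𝒢 : 𝒢 ≤ ℱ) (P : Measure Ω) [IsProbabilityMeasure P] (Z : SimpleFunc Ω 𝔛) :
    ∀ᵐ ω ∂P, φ (condExpSimple 𝒢 P Z ω) ≤ (P[fun ω => φ (Z ω) | 𝒢]) ω := by
  filter_upwards [condExpSimple_ae_eq h𝒢 P Z, condProbEq_nonneg (𝒢 := 𝒢) P Z,
    sum_condProbEq h𝒢 P Z, condExp_comp_simpleFunc (𝒢 := 𝒢) P Z φ] with ω h1 h2 h3 h4
  rw [h1, h4]
  refine (hφ.finsetBarycenter_le hc h2 h3 isConvexPoint_convexify).trans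
    (Finset.sum_le_sum fun b hb => ?_)
  exact mul_le_mul_of_nonneg_left (hφ.convexify_le hc b) (h2 b hb)

theorem exists_stronglyMeasurable_condExpSimple_ae_eq [SecondCountableTopology 𝔛]
    [MeasurableSpace 𝔛] [BorelSpace 𝔛]
    (h𝒢 : 𝒢 ≤ ℱ) (P : Measure Ω) [IsProbabilityMeasure P] (Z : SimpleFunc Ω 𝔛) :
    ∃ Y : Ω → 𝔛, StronglyMeasurable[𝒢] Y ∧ condExpSimple 𝒢 P Z =ᵐ[P] Y :=
  ⟨_, (@measurable_finsetBarycenter _ _ _ _ _ _ _ _ 𝒢 Z.range (fun x => condProbEq 𝒢 P Z x)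
    (fun _ => stronglyMeasurable_condExp.measurable) convexify).stronglyMeasurable,
    condExpSimple_ae_eq h𝒢 P Z⟩

theorem dist_condExpSimple_le_add (h𝒢 : 𝒢 ≤ ℱ) (P : Measure Ω) [IsProbabilityMeasure P]
    (Z Z' : SimpleFunc Ω 𝔛) (X : Ω → 𝔛) {k k' : Ω → ℝ} (hk : Integrable k P) (hk' : Integrable k' P)
    (h : ∀ ω, dist (Z ω) (X ω) ≤ k ω) (h' : ∀ ω, dist (Z' ω) (X ω) ≤ k' ω) :
    ∀ᵐ ω ∂P, dist (condExpSimple 𝒢 P Z ω) (condExpSimple 𝒢 P Z' ω)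
      ≤ (P[k | 𝒢]) ω + (P[k' | 𝒢]) ω := by
  have hi : Integrable (fun ω => dist (Z ω) (Z' ω)) P :=
    SimpleFunc.integrable_of_isFiniteMeasure ((Z.pair Z').map fun p : 𝔛 × 𝔛 => dist p.1 p.2)
  filter_upwards [dist_condExpSimple_le h𝒢 P Z Z', condExp_add hk hk' 𝒢,
    condExp_mono (m := 𝒢) hi (hk.add hk') (Eventually.of_forall fun ω =>
      (dist_triangle_right _ _ (X ω)).trans (add_le_add (h ω) (h' ω)))] with ω h1 h2 h3
  exact (h1.trans h3).trans_eq h2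

end CondExpSimple

/-! ### Conditional expectations of approximation errors -/

section L1

variable {Ω : Type*} {𝒢 ℱ : MeasurableSpace Ω}

/-- Dominated convergence and the L¹ contraction property give convergence in L¹, hence a.s. along a
subsequence. Monotonicity of conditional expectation extends this to the whole sequence. -/
theorem condExp_tendsto_zero_of_antitone (P : Measure Ω) {k : ℕ → Ω → ℝ}
    (h0 : ∀ n ω, 0 ≤ k n ω) (hanti : ∀ ω, Antitone fun n => k n ω)
    (hlim : ∀ ω, Tendsto (fun n => k n ω) atTop (𝓝 0)) (hki : ∀ n, Integrable (k n) P) :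
    ∀ᵐ ω ∂P, Tendsto (fun n => (P[k n | 𝒢]) ω) atTop (𝓝 0) := by
  have hk : Tendsto (fun n => ∫ ω, k n ω ∂P) atTop (𝓝 0) := by
    simpa using tendsto_integral_of_dominated_convergence (f := fun _ => (0 : ℝ)) (k 0)
      (fun n => (hki n).aestronglyMeasurable) (hki 0)
      (fun n => Eventually.of_forall fun ω => by
        rw [Real.norm_of_nonneg (h0 n ω)]; exact hanti ω n.zero_le)
      (Eventually.of_forall hlim)
  have h1 : Tendsto (fun n => eLpNorm (P[k n | 𝒢] - 0) 1 P) atTop (𝓝 0) := by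
    refine tendsto_of_tendsto_of_tendsto_of_le_of_le tendsto_const_nhds
      (h := fun n => ENNReal.ofReal (∫ ω, k n ω ∂P)) ?_ (fun _ => zero_le) fun n => ?_
    · simpa using ENNReal.tendsto_ofReal hk
    · simp only [sub_zero]
      refine (eLpNorm_condExp_le_eLpNorm _ le_rfl).trans_eq ?_
      rw [eLpNorm_one_eq_lintegral_enorm,
        ofReal_integral_eq_lintegral_ofReal (hki n) (Eventually.of_forall (h0 n))]
      exact lintegral_congr fun ω => Real.enorm_of_nonneg (h0 n ω)
  obtain ⟨ns, hns, h⟩ := (tendstoInMeasure_of_tendsto_eLpNorm one_ne_zero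
    (fun n => integrable_condExp.aestronglyMeasurable) aestronglyMeasurable_zero
    h1).exists_seq_tendsto_ae
  have hle : ∀ᵐ ω ∂P, ∀ m n : ℕ, m ≤ n → (P[k n | 𝒢]) ω ≤ (P[k m | 𝒢]) ω := by
    rw [ae_all_iff]; intro m; rw [ae_all_iff]; intro n
    by_cases hmn : m ≤ n
    · filter_upwards [condExp_mono (m := 𝒢) (hki n) (hki m)
        (Eventually.of_forall fun ω => hanti ω hmn)] with ω hω _ using hω
    · exact Eventually.of_forall fun ω h => absurd h hmn
  filter_upwards [h, hle] with ω h1 h2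
  exact (tendsto_iff_tendsto_subseq_of_antitone (fun m n => h2 m n) hns.tendsto_atTop).2 h1

variable {E : Type*} [MetricSpace E] [SecondCountableTopology E] [MeasurableSpace E] [BorelSpace E]

theorem integrable_dist_nearestPt (P : Measure Ω) (e : ℕ → E) {F : Ω → E} (hF : Measurable F)
    (hi : Integrable (fun ω => dist (e 0) (F ω)) P) (n : ℕ) :
    Integrable (fun ω => dist (SimpleFunc.nearestPt e n (F ω)) (F ω)) P := by
  refine hi.mono'
    (((SimpleFunc.nearestPt e n).measurable.comp hF).dist hF).aestronglyMeasurable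
    (Eventually.of_forall fun ω => ?_)
  rw [Real.norm_of_nonneg dist_nonneg]
  have := SimpleFunc.edist_nearestPt_le e (F ω) n.zero_le
  rwa [edist_dist, edist_dist, ENNReal.ofReal_le_ofReal_iff dist_nonneg] at this

theorem condExp_dist_nearestPt_tendsto_zero (P : Measure Ω) (e : ℕ → E) {F : Ω → E}
    (hF : Measurable F) (hcl : ∀ ω, F ω ∈ closure (Set.range e))
    (hi : Integrable (fun ω => dist (e 0) (F ω)) P) :
    ∀ᵐ ω ∂P, Tendsto
      (fun n => (P[fun ω => dist (SimpleFunc.nearestPt e n (F ω)) (F ω) | 𝒢]) ω) atTop (𝓝 0) := by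
  refine condExp_tendsto_zero_of_antitone P (fun _ _ => dist_nonneg) (fun ω m n hmn => ?_)
    (fun ω => tendsto_iff_dist_tendsto_zero.1 (SimpleFunc.tendsto_nearestPt (hcl ω)))
    (integrable_dist_nearestPt P e hF hi)
  -- The point chosen at stage `m` is still a candidate at stage `n`, so the error cannot grow.
  have := SimpleFunc.edist_nearestPt_le e (F ω) ((SimpleFunc.nearestPtInd_le e m (F ω)).trans hmn)
  rwa [edist_dist, edist_dist, ENNReal.ofReal_le_ofReal_iff dist_nonneg] at this

end L1

/-! ### Existence of the conditional expectation and the limit in Jensen's inequality -/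

section CondExp

variable {𝔛 : Type*} [MetricSpace 𝔛] [ConvexCombinationSpace 𝔛] [MeasurableSpace 𝔛] [BorelSpace 𝔛]
  [SecondCountableTopology 𝔛] {Ω : Type*} {𝒢 ℱ : MeasurableSpace Ω} {P : Measure Ω}

omit [ConvexCombinationSpace 𝔛] in
theorem IntegrableElement.integrable_dist [IsProbabilityMeasure P] {X : Ω → 𝔛}
    (hX : IntegrableElement P X) (b : 𝔛) : Integrable (fun ω => dist b (X ω)) P := by
  obtain ⟨hm, a, ha⟩ := hX
  refine ((integrable_const (dist b a)).add ha).mono'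
    (measurable_const.dist hm).aestronglyMeasurable (Eventually.of_forall fun ω => ?_)
  rw [Real.norm_of_nonneg dist_nonneg]
  exact dist_triangle _ _ _

theorem IntegrableElement.exists_isCondExp [CompleteSpace 𝔛] [IsProbabilityMeasure P] (h𝒢 : 𝒢 ≤ ℱ)
    {u : ℕ → 𝔛} (hu : DenseRange u) {X : Ω → 𝔛} (hX : IntegrableElement P X) :
    ∃ Y : Ω → 𝔛, IsCondExp 𝒢 P u X hX.1 Y := by
  have : Nonempty 𝔛 := ⟨u 0⟩
  set Z : ℕ → SimpleFunc Ω 𝔛 := fun n => (SimpleFunc.nearestPt u n).comp X hX.1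
  -- Passing to 𝒢-measurable versions makes the pointwise limit 𝒢-measurable on all of `Ω`.
  choose Y hYm hY using fun n => exists_stronglyMeasurable_condExpSimple_ae_eq h𝒢 P (Z n)
  refine ⟨fun ω => limUnder atTop fun n => Y n ω,
    (@StronglyMeasurable.limUnder _ _ _ 𝒢 _ _ _ _ _ _ _ hYm).measurable, ?_⟩
  have hi := hX.integrable_dist (u 0)
  have h1 : ∀ᵐ ω ∂P, ∀ m n, dist (condExpSimple 𝒢 P (Z m) ω) (condExpSimple 𝒢 P (Z n) ω)
      ≤ (P[fun ω => dist (SimpleFunc.nearestPt u m (X ω)) (X ω) | 𝒢]) ω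
        + (P[fun ω => dist (SimpleFunc.nearestPt u n (X ω)) (X ω) | 𝒢]) ω := by
    rw [ae_all_iff]; intro m; rw [ae_all_iff]; intro n
    exact dist_condExpSimple_le_add h𝒢 P (Z m) (Z n) X (integrable_dist_nearestPt P u hX.1 hi m)
      (integrable_dist_nearestPt P u hX.1 hi n) (fun _ => le_rfl) fun _ => le_rfl
  filter_upwards [h1, ae_all_iff.2 hY, condExp_dist_nearestPt_tendsto_zero (𝒢 := 𝒢) P u hX.1
    (fun ω => hu (X ω)) hi] with ω h1 h2 h3
  simp only [h2] at h1 ⊢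
  have hC : CauchySeq fun n => Y n ω := by
    refine Metric.cauchySeq_iff'.2 fun ε hε => ?_
    obtain ⟨N, hN⟩ := eventually_atTop.1 (h3.eventually (gt_mem_nhds (half_pos hε)))
    exact ⟨N, fun n hn => (h1 n N).trans_lt (by linarith [hN n hn, hN N le_rfl])⟩
  exact hC.tendsto_limUnder.congr fun n => (h2 n).symm

theorem IsCondExp.midpointConvex_le [IsProbabilityMeasure P] (h𝒢 : 𝒢 ≤ ℱ)
    {u : ℕ → 𝔛} (hu : DenseRange u) {φ : 𝔛 → ℝ} (hφ : MidpointConvex φ) (hφc : Continuous φ)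
    {X : Ω → 𝔛} (hX : IntegrableElement P X) (hφX : Integrable (fun ω => φ (X ω)) P)
    {Y : Ω → 𝔛} (hY : IsCondExp 𝒢 P u X hX.1 Y) :
    ∀ᵐ ω ∂P, φ (Y ω) ≤ (P[fun ω => φ (X ω) | 𝒢]) ω := by
  set g : 𝔛 → 𝔛 × ℝ := fun x => (x, φ x)
  have hg : Continuous g := by fun_prop
  have hgX : Measurable fun ω => g (X ω) := hg.measurable.comp hX.1
  -- approximation of `X` by simple functions that also approximates `φ ∘ X`
  set W : ℕ → SimpleFunc Ω (𝔛 × ℝ) := fun n => (SimpleFunc.nearestPt (g ∘ u) n).comp _ hgX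
  set V : ℕ → SimpleFunc Ω 𝔛 := fun n => (W n).map Prod.fst
  have hV : ∀ n ω, W n ω = g (V n ω) := fun n ω => rfl
  set k : ℕ → Ω → ℝ := fun n ω => dist (SimpleFunc.nearestPt (g ∘ u) n (g (X ω))) (g (X ω))
  -- The product carries the maximum metric, so one error `k n` controls both the point and the
  -- value of `φ`.
  have hkV : ∀ n ω, dist (V n ω) (X ω) ≤ k n ω := fun n ω => le_max_left _ _
  have hkφ : ∀ n ω, φ (V n ω) ≤ φ (X ω) + k n ω := fun n ω => by
    have h : dist (φ (V n ω)) (φ (X ω)) ≤ k n ω := le_max_right _ _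
    rw [Real.dist_eq] at h
    linarith [le_abs_self (φ (V n ω) - φ (X ω))]
  have hi0 : Integrable (fun ω => dist ((g ∘ u) 0) (g (X ω))) P := by
    refine ((hX.integrable_dist (u 0)).add ((integrable_const (φ (u 0))).sub hφX).norm).mono'
      (measurable_const.dist hgX).aestronglyMeasurable (Eventually.of_forall fun ω => ?_)
    rw [Real.norm_of_nonneg dist_nonneg]
    exact max_le_add_of_nonneg dist_nonneg dist_nonneg
  have hki : ∀ n, Integrable (k n) P := integrable_dist_nearestPt P (g ∘ u) hgX hi0
  -- Continuity of `φ` makes the points of the graph over the `u j` dense in the graph.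
  have hk0 := condExp_dist_nearestPt_tendsto_zero (𝒢 := 𝒢) P (g ∘ u) hgX (fun ω => by
    rw [Set.range_comp]
    exact image_closure_subset_closure_image hg ⟨_, hu (X ω), rfl⟩) hi0
  set Z : ℕ → SimpleFunc Ω 𝔛 := fun n => (SimpleFunc.nearestPt u n).comp X hX.1
  have hi := hX.integrable_dist (u 0)
  have h1 : ∀ᵐ ω ∂P, ∀ m n, dist (condExpSimple 𝒢 P (Z m) ω) (condExpSimple 𝒢 P (V n) ω)
      ≤ (P[fun ω => dist (SimpleFunc.nearestPt u m (X ω)) (X ω) | 𝒢]) ω + (P[k n | 𝒢]) ω := by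
    rw [ae_all_iff]; intro m; rw [ae_all_iff]; intro n
    exact dist_condExpSimple_le_add h𝒢 P (Z m) (V n) X (integrable_dist_nearestPt P u hX.1 hi m)
      (hki n) (fun _ => le_rfl) (hkV n)
  have h2 : ∀ᵐ ω ∂P, ∀ n, φ (condExpSimple 𝒢 P (V n) ω)
      ≤ (P[fun ω => φ (X ω) | 𝒢]) ω + (P[k n | 𝒢]) ω := by
    rw [ae_all_iff]; intro n
    have hiV : Integrable (fun ω => φ (V n ω)) P :=
      SimpleFunc.integrable_of_isFiniteMeasure ((V n).map φ)
    filter_upwards [hφ.condExpSimple_le hφc h𝒢 P (V n), condExp_add hφX (hki n) 𝒢,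
      condExp_mono (m := 𝒢) hiV (hφX.add (hki n)) (Eventually.of_forall (hkφ n))] with ω h1 h2 h3
    exact (h1.trans h3).trans_eq h2
  filter_upwards [h1, h2, hk0, hY.2, condExp_dist_nearestPt_tendsto_zero (𝒢 := 𝒢) P u hX.1
    (fun ω => hu (X ω)) hi] with ω h1 h2 h3 h4 h5
  -- Let `m` tend to infinity in `h1` with `n` fixed.
  have h6 : ∀ n, dist (Y ω) (condExpSimple 𝒢 P (V n) ω) ≤ (P[k n | 𝒢]) ω := fun n => by
    refine le_of_tendsto_of_tendsto' (h4.dist tendsto_const_nhds) (h5.add tendsto_const_nhds)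
      (fun m => h1 m n) |>.trans_eq (zero_add _)
  have h7 : Tendsto (fun n => condExpSimple 𝒢 P (V n) ω) atTop (𝓝 (Y ω)) :=
    tendsto_iff_dist_tendsto_zero.2 (squeeze_zero (fun _ => dist_nonneg)
      (fun n => (dist_comm _ _).trans_le (h6 n)) h3)
  refine le_of_tendsto_of_tendsto' ((hφc.tendsto _).comp h7) (tendsto_const_nhds.add h3) h2
    |>.trans_eq (add_zero _)

end CondExp

end ConvexCombinationSpace

end

theorem proposition4p11 {𝔛 : Type*} [MetricSpace 𝔛] [CompleteSpace 𝔛]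
    [TopologicalSpace.SeparableSpace 𝔛] [MeasurableSpace 𝔛] [BorelSpace 𝔛]
    [ConvexCombinationSpace 𝔛]
    {Ω : Type*} {𝒢 ℱ : MeasurableSpace Ω} (h𝒢 : 𝒢 ≤ ℱ)
    (P : Measure[ℱ] Ω) [IsProbabilityMeasure P]
    -- the points from which conditional expectations are built: `u 0` is a value of the
    -- convexification operator, and `u 1, u 2, …` are dense
    (u : ℕ → 𝔛) (hu0 : u 0 ∈ Set.range (ConvexCombinationSpace.convexify (𝔛 := 𝔛)))
    (hu : DenseRange fun j : ℕ => u (j + 1))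
    (φ : 𝔛 → ℝ) (hφ : ConvexCombinationSpace.MidpointConvex φ) (hφc : Continuous φ)
    (X : Ω → 𝔛) (hX : ConvexCombinationSpace.IntegrableElement P X)
    (hφX : Integrable (fun ω => φ (X ω)) P) :
    (∃ Y : Ω → 𝔛, ConvexCombinationSpace.IsCondExp 𝒢 P u X hX.1 Y) ∧
      ∀ Y : Ω → 𝔛, ConvexCombinationSpace.IsCondExp 𝒢 P u X hX.1 Y →
        ∀ᵐ ω ∂P, φ (Y ω) ≤ (P[fun ω => φ (X ω) | 𝒢]) ω := by
  have := UniformSpace.secondCountable_of_separable 𝔛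
  have hd : DenseRange u := hu.mono (Set.range_comp_subset_range (· + 1) u)
  exact ⟨hX.exists_isCondExp h𝒢 hd,
    fun Y hY => hY.midpointConvex_le h𝒢 hd hφ hφc hX hφX⟩
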